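/- Let $(V,\omega,H)$ be a linear Hamiltonian system: $V$ is a finite-dimensional real vector space, $\omega$ a symplectic form on $V$, and $H$ a quadratic form on $V$. Let $L$ be the linear operator defined by $\omega(x,Ly)=B_H(x,y)$, where $B_H$ is the symmetric bilinear form with $B_H(x,x)=H(x)$; the eigenvalues of the system are the complex eigenvalues of $L$. The codimension of the system is the codimension, in the Lie algebra $\mathfrak{sp}(V,\omega)$, of the family of operators with the same Jordan type as $L$ (the eigenvalues being allowed to vary), that is, $\operatorname{codim}\{[B,L] : B\in\mathfrak{sp}(V,\omega)\}-m$, where $m$ is the number of moduli: each pair $\pm a$ or $\pm ib$ of non-zero real or imaginary eigenvalues contributes $1$ to $m$, each quadruplet $\pm a\pm ib$ with $a,b\neq0$ contributes $2$, and the eigenvalue $0$ contributes $0$. Suppose that $H$ has signature $0$ and that the system has codimension at most $1$. Then $(V,\omega,H)$ splits as a direct sum $\bigoplus_{j=1}^r (V_j,\omega_j,H_j)$ of symplectic subsystems such that the set of eigenvalues of the $j$-th subsystem is a quadruplet $\{\lambda_j,-\lambda_j,\bar\lambda_j,-\bar\lambda_j\}$ and these quadruplets are distinct for different $j$. For every such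 splitting, each $V_j$ has dimension $2$ or $4$; each $\lambda_j$ is non-zero; if $\dim V_j=2$ then $\lambda_j$ is real or imaginary; and if $\dim V_j=4$ and $\lambda_j$ is real or imaginary, then $\lambda_j$ has algebraic multiplicity $2$ and geometric multiplicity $1$. Define $$\delta(j)=\begin{cases}0 & \dim V_j=2,\ \lambda_j \text{ imaginary},\\ 1 & \dim V_j=4,\ \lambda_j\text{ imaginary},\\ 2 & \dim V_j=4,\ \operatorname{Re}\lambda_j\neq0\neq\operatorname{Im}\lambda_j,\\ 3 & \dim V_j=4,\ \lambda_j \text{ real},\\ 2 & \dim V_j=2,\ \lambda_j\text{ real}.\end{cases}$$ Then the number of Lagrangian subspaces of $V$ contained in the null-cone $\mathcal N=H^{-1}(0)$ is exactly $\prod_{j=1}^r\delta(j)$ (in particular it is finite). -/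

import Mathlib

noncomputable section

open scoped TensorProduct

/-- A linear Hamiltonian system on a real vector space `V`: a symplectic form `ω`
and a quadratic Hamiltonian `H` (possibly degenerate). -/
structure LinearHamiltonianSystem (V : Type*) [AddCommGroup V] [Module ℝ V] where
  /-- the symplectic form -/
  ω : LinearMap.BilinForm ℝ V
  /-- the Hamiltonian -/
  H : QuadraticForm ℝ V
  isAlt : ω.IsAlt
  nondegenerate : ω.Nondegenerate

namespace LinearHamiltonianSystem

variable {V : Type*} [AddCommGroup V] [Module ℝ V] [FiniteDimensional ℝ V]

/-- The linear vector field `L = Ω⁻¹ S`, where `H x = xᵀ S x` and `ω x y = xᵀ Ω y`.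
See `ω_vectorField` for the defining property `ω x (L y) = xᵀ S y`. -/
def vectorField (S : LinearHamiltonianSystem V) : Module.End ℝ V :=
  -((S.ω.toDual S.nondegenerate).symm.toLinearMap ∘ₗ QuadraticMap.associated S.H)

theorem ω_vectorField (S : LinearHamiltonianSystem V) (x y : V) :
    S.ω x (S.vectorField y) = QuadraticMap.associated (R := ℝ) S.H x y := by
  have h : S.ω (S.vectorField y) x = -QuadraticMap.associated (R := ℝ) S.H y x := by
    simp [vectorField, LinearMap.BilinForm.apply_toDual_symm_apply]
  have h2 := S.isAlt.neg_eq (S.vectorField y) x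
  rw [← h2, h, neg_neg]
  exact (QuadraticMap.associated_isSymm ℝ S.H) y x

/-- The complexification of the vector field. -/
def complexVectorField (S : LinearHamiltonianSystem V) : Module.End ℂ (ℂ ⊗[ℝ] V) :=
  S.vectorField.baseChange ℂ

/-- The set of (complex) eigenvalues of the system. -/
def eigenvalues (S : LinearHamiltonianSystem V) : Set ℂ :=
  {z | S.complexVectorField.HasEigenvalue z}

/-- Algebraic multiplicity of `z` as an eigenvalue of the system. -/
def algMultiplicity (S : LinearHamiltonianSystem V) (z : ℂ) : ℕ :=
  S.complexVectorField.charpoly.rootMultiplicity z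

/-- Geometric multiplicity of `z` as an eigenvalue of the system. -/
def geomMultiplicity (S : LinearHamiltonianSystem V) (z : ℂ) : ℕ :=
  Module.finrank ℂ (S.complexVectorField.eigenspace z)

/-- The Lie algebra `sp(V, ω)` of Hamiltonian operators: `ω (A x) y = -ω x (A y)`. -/
def hamiltonianOperators (S : LinearHamiltonianSystem V) : Submodule ℝ (Module.End ℝ V) :=
  S.ω.skewAdjointSubmodule

theorem vectorField_mem (S : LinearHamiltonianSystem V) :
    S.vectorField ∈ S.hamiltonianOperators := by
  rw [hamiltonianOperators, LinearMap.mem_skewAdjointSubmodule]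
  intro x y
  change S.ω (S.vectorField x) y = S.ω x (-S.vectorField y)
  rw [map_neg, ω_vectorField, ← S.isAlt.neg_eq, ω_vectorField]
  exact congrArg Neg.neg ((QuadraticMap.associated_isSymm ℝ S.H) y x)

/-- The tangent space at `L` to the orbit of `L` under conjugation by the symplectic group,
namely `{B L - L B | B ∈ sp(V, ω)}`. -/
def orbitTangentSpace (S : LinearHamiltonianSystem V) : Submodule ℝ (Module.End ℝ V) :=
  S.hamiltonianOperators.map
    (LinearMap.mulRight ℝ S.vectorField - LinearMap.mulLeft ℝ S.vectorField)

/-- The number of real parameters (moduli) on which the eigenvalues depend when the Jordan type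
is kept: one for each pair `±a` or `±ib` of nonzero real or imaginary eigenvalues, two for each
quadruplet `±a ± ib` with `a, b ≠ 0`, none for the eigenvalue `0`. It is counted here as the
number of distinct nonzero eigenvalues modulo `z ↦ -z`. -/
def moduliNumber (S : LinearHamiltonianSystem V) : ℕ :=
  {z ∈ S.eigenvalues | 0 < z.re ∨ (z.re = 0 ∧ 0 < z.im)}.ncard

/-- The codimension of the system: the codimension in `sp(V, ω)` of the family of all systems
of the same Jordan type (with arbitrary eigenvalues), that is the codimension of the symplectic
orbit minus the number of moduli. -/
def codimension (S : LinearHamiltonianSystem V) : ℤ :=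
  (Module.finrank ℝ S.hamiltonianOperators : ℤ) - Module.finrank ℝ S.orbitTangentSpace
    - S.moduliNumber

/-- The signature of `H`: positive minus negative index of inertia. -/
def signature (S : LinearHamiltonianSystem V) : ℤ := (sigPos S.H : ℤ) - sigNeg S.H

/-- The null-cone `H⁻¹(0)`. -/
def nullCone (S : LinearHamiltonianSystem V) : Set V := {x | S.H x = 0}

/-- Lagrangian subspaces: those equal to their own symplectic orthogonal. -/
def IsLagrangian (S : LinearHamiltonianSystem V) (W : Submodule ℝ V) : Prop :=
  S.ω.orthogonal W = W

/-- The subsystem on a symplectic subspace `W`. -/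
def restrict (S : LinearHamiltonianSystem V) (W : Submodule ℝ V)
    (hW : (S.ω.restrict W).Nondegenerate) : LinearHamiltonianSystem W where
  ω := S.ω.restrict W
  H := S.H.restrict W
  isAlt := fun x => S.isAlt x
  nondegenerate := hW

/-- The eigenvalue quadruplet `{z, -z, z̄, -z̄}`. -/
def quadruplet (z : ℂ) : Set ℂ :=
  {z, -z, (starRingEnd ℂ) z, -(starRingEnd ℂ) z}

/-- A splitting of a system as a direct sum of `r` symplectic subsystems, the eigenvalues of the
`j`-th one forming a single quadruplet, different components having different quadruplets. -/
structure Splitting (S : LinearHamiltonianSystem V) (r : ℕ) where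
  /-- the components `V_j` -/
  comp : Fin r → Submodule ℝ V
  isInternal : DirectSum.IsInternal comp
  symplectic : ∀ j, (S.ω.restrict (comp j)).Nondegenerate
  ω_eq_zero : ∀ i j, i ≠ j → ∀ x ∈ comp i, ∀ y ∈ comp j, S.ω x y = 0
  H_add : ∀ i j, i ≠ j → ∀ x ∈ comp i, ∀ y ∈ comp j, S.H (x + y) = S.H x + S.H y
  /-- a representative `λ_j` of the `j`-th quadruplet -/
  eigenvalue : Fin r → ℂ
  eigenvalues_eq : ∀ j,
    (S.restrict (comp j) (symplectic j)).eigenvalues = quadruplet (eigenvalue j)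
  distinct : ∀ i j, i ≠ j → quadruplet (eigenvalue i) ≠ quadruplet (eigenvalue j)

/-- The `j`-th subsystem `(V_j, ω_j, H_j)` of a splitting. -/
def Splitting.subsystem {S : LinearHamiltonianSystem V} {r : ℕ} (D : S.Splitting r) (j : Fin r) :
    LinearHamiltonianSystem (D.comp j) :=
  S.restrict (D.comp j) (D.symplectic j)

open Classical in
/-- The factor attached to a component of dimension `d` with eigenvalue `z ≠ 0`. -/
def factor (d : ℕ) (z : ℂ) : ℕ :=
  if d = 2 ∧ z.re = 0 then 0
  else if d = 4 ∧ z.re = 0 then 1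
  else if d = 4 ∧ z.re ≠ 0 ∧ z.im ≠ 0 then 2
  else if d = 4 ∧ z.im = 0 then 3
  else if d = 2 ∧ z.im = 0 then 2
  else 0

/-- The function `δ(j)` of a splitting. -/
def Splitting.δ {S : LinearHamiltonianSystem V} {r : ℕ} (D : S.Splitting r) (j : Fin r) : ℕ :=
  factor (Module.finrank ℝ (D.comp j)) (D.eigenvalue j)

end LinearHamiltonianSystem

end

noncomputable section

open scoped TensorProduct
open Module Polynomial

/-! By rank-nullity the codimension is the dimension of the centralizer of `L` in `sp(V, ω)` minus
the number of moduli (`codimension_eq`). The centralizer contains the block-diagonal sum of the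
centralizers of the components, and each component's centralizer is at least as large as its number
of moduli. So codimension at most 1 leaves every component an excess of at most 1.

Two families of elements of the centralizer bound the size of a component with nonzero eigenvalues.
Odd polynomials in `L` bound the degree of the minimal polynomial of `L²`
(`natDegree_minpoly_sq_le`). Products of eigenvectors for `z` and `-z` exclude geometric
multiplicity above 1 (`two_mul_finrank_eigenspace_le`). Together they force dimension 2 or 4 and a
known Jordan type, recorded in `IsSimpleBlock`. The eigenvalue 0 is excluded by parity: `ker L` is
the radical of `H`, of even dimension when the signature is 0, while an excess of 1 allows dimension
at most 1.

Since `H x = ω x (L x)`, a Lagrangian subspace lies in the null-cone exactly when it is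
`L`-invariant (`mem_nullLagrangians_iff`). The projections to the components are polynomials in
`L²`, so an invariant Lagrangian is a direct sum of invariant Lagrangians of the components and the
counts multiply (`nullLagrangiansEquiv`). Within one block the count is linear algebra of invariant
subspaces: non-real eigenvalues exclude invariant lines, and when the eigenvalues are off the
imaginary axis the generalized eigenspaces on its two sides give two complementary Lagrangians. -/

/-! ### Rank and parity preliminaries. -/

theorem Submodule.finrank_map_add_finrank_inf_ker {K V W : Type*} [Field K] [AddCommGroup V]
    [Module K V] [AddCommGroup W] [Module K W] [FiniteDimensional K V] (f : V →ₗ[K] W)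
    (p : Submodule K V) :
    finrank K (p.map f) + finrank K (p ⊓ LinearMap.ker f : Submodule K V) = finrank K p := by
  have h := LinearMap.finrank_range_add_finrank_ker (f.domRestrict p)
  rw [LinearMap.range_domRestrict, LinearMap.ker_domRestrict] at h
  rw [← h, ← Submodule.finrank_map_subtype_eq p, Submodule.map_comap_subtype]

/-- A skew matrix of odd size has zero determinant, since `det A = det Aᵀ = -det A`. -/
theorem LinearMap.BilinForm.even_finrank_of_isAlt {V : Type*} [AddCommGroup V] [Module ℝ V]
    [FiniteDimensional ℝ V] {B : LinearMap.BilinForm ℝ V} (hB : B.IsAlt) (hn : B.Nondegenerate) :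
    Even (finrank ℝ V) := by
  classical
  let b := Module.finBasis ℝ V
  have hdet : (BilinForm.toMatrix b B).det ≠ 0 :=
    (BilinForm.nondegenerate_iff_det_ne_zero b).1 hn
  have hT : (BilinForm.toMatrix b B).transpose = -BilinForm.toMatrix b B := by
    ext i j
    simp [BilinForm.toMatrix_apply, ← hB.neg_eq (b j) (b i)]
  have h := congrArg Matrix.det hT
  rw [Matrix.det_transpose, Matrix.det_neg, Fintype.card_fin] at h
  by_contra hodd
  rw [Nat.not_even_iff_odd] at hodd
  rw [hodd.neg_one_pow] at h
  apply hdet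
  linarith

/-! ### Complexification of operators and of the symplectic form. -/

namespace Complexification

variable {V : Type*} [AddCommGroup V] [Module ℝ V]

/-- The real part of a vector of the complexification. -/
def rePart : ℂ ⊗[ℝ] V →ₗ[ℝ] V :=
  (TensorProduct.lid ℝ V).toLinearMap ∘ₗ TensorProduct.map Complex.reLm LinearMap.id

/-- The imaginary part of a vector of the complexification. -/
def imPart : ℂ ⊗[ℝ] V →ₗ[ℝ] V :=
  (TensorProduct.lid ℝ V).toLinearMap ∘ₗ TensorProduct.map Complex.imLm LinearMap.id

@[simp] theorem rePart_tmul (c : ℂ) (x : V) : rePart (c ⊗ₜ[ℝ] x) = c.re • x := by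
  simp [rePart]

@[simp] theorem imPart_tmul (c : ℂ) (x : V) : imPart (c ⊗ₜ[ℝ] x) = c.im • x := by
  simp [imPart]

theorem eq_rePart_add_imPart (u : ℂ ⊗[ℝ] V) :
    u = (1 : ℂ) ⊗ₜ[ℝ] rePart u + Complex.I ⊗ₜ[ℝ] imPart u := by
  induction u with
  | zero => simp
  | tmul c x =>
    rw [rePart_tmul, imPart_tmul, ← TensorProduct.smul_tmul, ← TensorProduct.smul_tmul,
      ← TensorProduct.add_tmul]
    congr 1
    apply Complex.ext <;> simp
  | add u v hu hv =>
    rw [map_add, map_add, TensorProduct.tmul_add, TensorProduct.tmul_add]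
    nth_rewrite 1 [hu, hv]
    abel

theorem ext_parts {u v : ℂ ⊗[ℝ] V} (h₁ : rePart u = rePart v) (h₂ : imPart u = imPart v) :
    u = v := by
  rw [eq_rePart_add_imPart u, eq_rePart_add_imPart v, h₁, h₂]

theorem rePart_baseChange (f : End ℝ V) (u : ℂ ⊗[ℝ] V) :
    rePart (f.baseChange ℂ u) = f (rePart u) := by
  induction u with
  | zero => simp
  | tmul c x => simp
  | add u v hu hv => simp [hu, hv]

theorem imPart_baseChange (f : End ℝ V) (u : ℂ ⊗[ℝ] V) :
    imPart (f.baseChange ℂ u) = f (imPart u) := by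
  induction u with
  | zero => simp
  | tmul c x => simp
  | add u v hu hv => simp [hu, hv]

theorem baseChange_injective : Function.Injective (End.baseChangeHom ℝ ℂ V) := by
  intro f g h
  ext x
  have : rePart (f.baseChange ℂ ((1 : ℂ) ⊗ₜ[ℝ] x)) = rePart (g.baseChange ℂ ((1 : ℂ) ⊗ₜ[ℝ] x)) :=
    congrArg rePart (LinearMap.congr_fun h ((1 : ℂ) ⊗ₜ[ℝ] x))
  simpa using this

/-- The map `(x, y) ↦ x + iy` embeds two copies of the real kernel into the complex one, whose real
dimension is twice its complex dimension. -/
theorem finrank_ker_le [FiniteDimensional ℝ V] (f : End ℝ V) :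
    finrank ℝ (LinearMap.ker f) ≤ finrank ℂ (LinearMap.ker (f.baseChange ℂ)) := by
  let φ : (LinearMap.ker f × LinearMap.ker f) →ₗ[ℝ] LinearMap.ker (f.baseChange ℂ) :=
    { toFun := fun p => ⟨(1 : ℂ) ⊗ₜ[ℝ] (p.1 : V) + Complex.I ⊗ₜ[ℝ] (p.2 : V), by
        simp [LinearMap.mem_ker.1 p.1.2, LinearMap.mem_ker.1 p.2.2]⟩
      map_add' := fun p q => by
        ext1; simp [TensorProduct.tmul_add]; abel
      map_smul' := fun c p => by
        ext1; simp [TensorProduct.tmul_smul, smul_add] }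
  have hφ : Function.Injective φ := by
    rw [← LinearMap.ker_eq_bot, LinearMap.ker_eq_bot']
    intro p hp
    have h : (1 : ℂ) ⊗ₜ[ℝ] (p.1 : V) + Complex.I ⊗ₜ[ℝ] (p.2 : V) = 0 := congrArg Subtype.val hp
    have h₁ := congrArg rePart h
    have h₂ := congrArg imPart h
    simp only [map_add, rePart_tmul, imPart_tmul, Complex.one_re, Complex.I_re, Complex.one_im,
      Complex.I_im, one_smul, zero_smul, add_zero, zero_add, map_zero] at h₁ h₂
    exact Prod.ext (Subtype.ext h₁) (Subtype.ext h₂)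
  have : Module.Finite ℝ (LinearMap.ker (f.baseChange ℂ)) :=
    Module.Finite.trans (R := ℝ) ℂ _
  have := LinearMap.finrank_le_finrank_of_injective hφ
  rw [← Module.finrank_mul_finrank ℝ ℂ (LinearMap.ker (f.baseChange ℂ)),
    Complex.finrank_real_complex, Module.finrank_prod] at this
  omega

/-- The real operator obtained by taking the real parts of the values of a complex operator. -/
def reOperator : End ℂ (ℂ ⊗[ℝ] V) →ₗ[ℝ] End ℝ V where
  toFun B := rePart ∘ₗ B.restrictScalars ℝ ∘ₗ TensorProduct.mk ℝ ℂ V 1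
  map_add' B B' := by ext; simp
  map_smul' c B := by ext; simp

/-- The real operator obtained by taking the imaginary parts of the values of a complex
operator. -/
def imOperator : End ℂ (ℂ ⊗[ℝ] V) →ₗ[ℝ] End ℝ V where
  toFun B := imPart ∘ₗ B.restrictScalars ℝ ∘ₗ TensorProduct.mk ℝ ℂ V 1
  map_add' B B' := by ext; simp
  map_smul' c B := by ext; simp

theorem reOperator_apply (B : End ℂ (ℂ ⊗[ℝ] V)) (x : V) :
    reOperator B x = rePart (B ((1 : ℂ) ⊗ₜ[ℝ] x)) := rfl

theorem imOperator_apply (B : End ℂ (ℂ ⊗[ℝ] V)) (x : V) :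
    imOperator B x = imPart (B ((1 : ℂ) ⊗ₜ[ℝ] x)) := rfl

theorem eq_zero_of_reOperator_imOperator {B : End ℂ (ℂ ⊗[ℝ] V)} (h₁ : reOperator B = 0)
    (h₂ : imOperator B = 0) : B = 0 := by
  ext x
  apply ext_parts
  · simpa [reOperator_apply] using LinearMap.congr_fun h₁ x
  · simpa [imOperator_apply] using LinearMap.congr_fun h₂ x

theorem re_baseChange_tmul (ω : LinearMap.BilinForm ℝ V) (u : ℂ ⊗[ℝ] V) (y : V) :
    (ω.baseChange ℂ u ((1 : ℂ) ⊗ₜ[ℝ] y)).re = ω (rePart u) y := by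
  induction u with
  | zero => simp
  | tmul c x => simp [mul_comm]
  | add u v hu hv => simp [hu, hv]

theorem im_baseChange_tmul (ω : LinearMap.BilinForm ℝ V) (u : ℂ ⊗[ℝ] V) (y : V) :
    (ω.baseChange ℂ u ((1 : ℂ) ⊗ₜ[ℝ] y)).im = ω (imPart u) y := by
  induction u with
  | zero => simp
  | tmul c x => simp [mul_comm]
  | add u v hu hv => simp [hu, hv]

theorem baseChange_skew {ω : LinearMap.BilinForm ℝ V} {f : End ℝ V}
    (h : ∀ x y, ω (f x) y = -ω x (f y)) (u v : ℂ ⊗[ℝ] V) :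
    ω.baseChange ℂ (f.baseChange ℂ u) v = -ω.baseChange ℂ u (f.baseChange ℂ v) := by
  induction u with
  | zero => simp
  | tmul c x =>
    induction v with
    | zero => simp
    | tmul d y => simp [h]
    | add v w hv hw => rw [map_add, hv, hw, map_add, map_add, neg_add]
  | add u w hu hw => simp only [map_add, LinearMap.add_apply, hu, hw, neg_add]

theorem baseChange_neg_eq {ω : LinearMap.BilinForm ℝ V}
    (h : ω.IsAlt) (u v : ℂ ⊗[ℝ] V) :
    -ω.baseChange ℂ u v = ω.baseChange ℂ v u := by
  induction u with
  | zero => simp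
  | tmul c x =>
    induction v with
    | zero => simp
    | tmul d y => simp [← h.neg_eq x y, mul_comm c d]
    | add v w hv hw => simp only [map_add, LinearMap.add_apply, ← hv, ← hw, neg_add]
  | add u w hu hw => simp only [map_add, LinearMap.add_apply, ← hu, ← hw, neg_add]

theorem eq_zero_of_baseChange_eq_zero {ω : LinearMap.BilinForm ℝ V} (hω : ω.Nondegenerate)
    {u : ℂ ⊗[ℝ] V} (hu : ∀ v, ω.baseChange ℂ u v = 0) : u = 0 := by
  apply ext_parts
  · rw [map_zero]
    apply hω.1
    intro y
    rw [← re_baseChange_tmul, hu, Complex.zero_re]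
  · rw [map_zero]
    apply hω.1
    intro y
    rw [← im_baseChange_tmul, hu, Complex.zero_im]

theorem baseChange_nondegenerate {ω : LinearMap.BilinForm ℝ V} (h : ω.IsAlt)
    (hω : ω.Nondegenerate) : (ω.baseChange ℂ).Nondegenerate := by
  refine ⟨fun u hu => eq_zero_of_baseChange_eq_zero hω hu, fun u hu =>
    eq_zero_of_baseChange_eq_zero hω fun v => ?_⟩
  rw [← baseChange_neg_eq h, hu v, neg_zero]

end Complexification

/-- If every eigenvalue of `A` is geometrically simple, then the dimension of the space is at most
the degree of any nonzero polynomial annihilating `A`. -/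
theorem Module.End.finrank_le_natDegree_of_finrank_eigenspace_le_one {K V : Type*} [Field K]
    [IsAlgClosed K] [AddCommGroup V] [Module K V] [FiniteDimensional K V] (A : End K V)
    {p : K[X]} (hp : p ≠ 0) (hA : ∀ z ∈ p.roots, finrank K (A.eigenspace z) ≤ 1) :
    finrank K (LinearMap.ker (aeval A p)) ≤ p.natDegree := by
  have hsplit := IsAlgClosed.splits p
  rw [hsplit.natDegree_eq_card_roots]
  have hker : LinearMap.ker (aeval A p) =
      LinearMap.ker (aeval A (p.roots.map fun a => X - C a).prod) := by
    conv_lhs => rw [hsplit.eq_prod_roots]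
    ext x
    simp [Algebra.algebraMap_eq_smul_one, hp]
  rw [hker]
  clear hker
  generalize p.roots = s at hA
  induction s using Multiset.induction with
  | empty =>
    rw [Multiset.map_zero, Multiset.prod_zero, map_one, End.one_eq_id, LinearMap.ker_id]
    simp
  | cons a s ih =>
    rw [Multiset.map_cons, Multiset.prod_cons, Multiset.card_cons, mul_comm, map_mul]
    set f := aeval A (s.map fun a => X - C a).prod
    set g := aeval A (X - C a)
    have hg : finrank K (LinearMap.ker g) ≤ 1 := by
      have h := hA a (Multiset.mem_cons_self a s)
      have hga : g = A - a • 1 := by simp [g, Algebra.algebraMap_eq_smul_one]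
      rwa [End.eigenspace_def, ← hga] at h
    have hf := ih fun z hz => hA z (Multiset.mem_cons_of_mem hz)
    have h := Submodule.finrank_map_add_finrank_inf_ker g (LinearMap.ker (f * g))
    have h₁ : finrank K ((LinearMap.ker (f * g)).map g) ≤ finrank K (LinearMap.ker f) := by
      apply Submodule.finrank_mono
      rintro _ ⟨x, hx, rfl⟩
      exact hx
    have h₂ : finrank K (LinearMap.ker (f * g) ⊓ LinearMap.ker g : Submodule K V) ≤
        finrank K (LinearMap.ker g) := Submodule.finrank_mono inf_le_right
    omega

/-! ### The centralizer, the codimension and the kernel of the vector field. -/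

namespace LinearHamiltonianSystem

variable {V : Type*} [AddCommGroup V] [Module ℝ V] [FiniteDimensional ℝ V]
  (S : LinearHamiltonianSystem V)

theorem ω_vectorField_left (x y : V) : S.ω (S.vectorField x) y = -S.ω x (S.vectorField y) := by
  have h := (LinearMap.mem_skewAdjointSubmodule _).1 S.vectorField_mem x y
  rw [h]
  simp

theorem ω_sq_left (x y : V) :
    S.ω ((S.vectorField ^ 2) x) y = S.ω x ((S.vectorField ^ 2) y) := by
  simp [pow_two, ω_vectorField_left]

theorem ω_aeval_left (p : ℝ[X]) (x y : V) :
    S.ω (aeval S.vectorField p x) y = S.ω x (aeval (-S.vectorField) p y) := by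
  induction p using Polynomial.induction_on' generalizing x y with
  | add p q hp hq => simp [hp, hq]
  | monomial n a =>
    simp only [aeval_monomial, Module.End.mul_apply, Module.algebraMap_end_apply, map_smul,
      LinearMap.smul_apply]
    congr 1
    induction n generalizing y with
    | zero => simp
    | succ n ih =>
      rw [pow_succ', pow_succ, End.mul_apply, End.mul_apply, ω_vectorField_left, ← map_neg, ih]
      rfl

theorem ω_aeval_sq_left (p : ℝ[X]) (x y : V) :
    S.ω (aeval (S.vectorField ^ 2) p x) y = S.ω x (aeval (S.vectorField ^ 2) p y) := by
  induction p using Polynomial.induction_on' generalizing x y with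
  | add p q hp hq => simp [hp, hq]
  | monomial n a =>
    simp only [aeval_monomial, Module.End.mul_apply, Module.algebraMap_end_apply, map_smul,
      LinearMap.smul_apply]
    congr 1
    induction n generalizing y with
    | zero => simp
    | succ n ih =>
      rw [pow_succ', End.mul_apply, ω_sq_left, ih, ← End.mul_apply, ← pow_succ, ← pow_succ']

theorem even_finrank (S : LinearHamiltonianSystem V) : Even (finrank ℝ V) :=
  LinearMap.BilinForm.even_finrank_of_isAlt S.isAlt S.nondegenerate

theorem isLagrangian_iff {W : Submodule ℝ V} :
    S.IsLagrangian W ↔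
      (∀ x ∈ W, ∀ y ∈ W, S.ω x y = 0) ∧ 2 * finrank ℝ W = finrank ℝ V := by
  have hfin := LinearMap.BilinForm.finrank_orthogonal S.nondegenerate W
  have hle := Submodule.finrank_le W
  constructor
  · intro h
    rw [IsLagrangian] at h
    refine ⟨fun x hx y hy => ?_, ?_⟩
    · rw [← h] at hy
      exact LinearMap.BilinForm.mem_orthogonal_iff.1 hy x hx
    · rw [h] at hfin
      omega
  · rintro ⟨h₁, h₂⟩
    rw [IsLagrangian]
    symm
    apply Submodule.eq_of_le_of_finrank_eq
    · intro y hy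
      exact LinearMap.BilinForm.mem_orthogonal_iff.2 fun x hx => h₁ x hx y hy
    · omega

/-- The operators of `sp(V, ω)` commuting with the vector field. -/
def centralizer : Submodule ℝ (End ℝ V) :=
  S.hamiltonianOperators ⊓
    LinearMap.ker (LinearMap.mulRight ℝ S.vectorField - LinearMap.mulLeft ℝ S.vectorField)

theorem mem_centralizer {B : End ℝ V} :
    B ∈ S.centralizer ↔ (∀ x y, S.ω (B x) y = -S.ω x (B y)) ∧
      ∀ x, B (S.vectorField x) = S.vectorField (B x) := by
  rw [centralizer, Submodule.mem_inf, hamiltonianOperators, LinearMap.mem_skewAdjointSubmodule,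
    LinearMap.mem_ker]
  refine and_congr ?_ ?_
  · refine forall₂_congr fun x y => ?_
    simp
  · simp [sub_eq_zero, LinearMap.ext_iff]

/-- The orbit tangent space is the image of `sp(V, ω)` under the commutator with `L`, and the
centralizer is the kernel there. -/
theorem codimension_eq :
    S.codimension = (finrank ℝ S.centralizer : ℤ) - S.moduliNumber := by
  have h := Submodule.finrank_map_add_finrank_inf_ker
    (LinearMap.mulRight ℝ S.vectorField - LinearMap.mulLeft ℝ S.vectorField)
    S.hamiltonianOperators
  rw [codimension, orbitTangentSpace, centralizer]
  omega

/-- The polar form of `H` is `2 ω(·, L ·)` and `ω` is nondegenerate. -/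
theorem radical_eq_ker : S.H.radical = LinearMap.ker S.vectorField := by
  ext x
  rw [QuadraticMap.mem_radical_iff', LinearMap.mem_ker]
  constructor
  · rintro ⟨h₀, h⟩
    apply S.nondegenerate.2
    intro y
    rw [ω_vectorField, QuadraticMap.associated_apply, add_comm, h, h₀]
    simp
  · intro hx
    have h : ∀ y, S.H (x + y) - S.H x - S.H y = 0 := by
      intro y
      have h₁ := S.ω_vectorField y x
      rw [hx, map_zero] at h₁
      have h₂ := LinearMap.congr_fun₂ (QuadraticMap.two_nsmul_associated ℝ S.H) y x
      rw [LinearMap.smul_apply, LinearMap.smul_apply, ← h₁, smul_zero] at h₂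
      rw [QuadraticMap.polarBilin_apply_apply, QuadraticMap.polar, add_comm] at h₂
      linarith
    have h₀ : S.H x = 0 := by
      have := S.ω_vectorField x x
      rw [hx, map_zero, QuadraticMap.associated_eq_self_apply] at this
      exact this.symm
    refine ⟨h₀, fun y => ?_⟩
    have := h y
    linarith

/-- With equal indices of inertia `p`, the radical has dimension `dim V - 2p`, and `dim V` is even.
-/
theorem even_finrank_ker_of_signature_eq_zero (h : S.signature = 0) :
    Even (finrank ℝ (LinearMap.ker S.vectorField)) := by
  have h₁ := QuadraticForm.sigPos_add_sigNeg_add_radical (Q := S.H)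
  rw [radical_eq_ker] at h₁
  have h₂ := S.even_finrank
  rw [signature] at h
  rw [← h₁] at h₂
  have h₃ : sigPos S.H = sigNeg S.H := by omega
  rw [h₃] at h₂
  grind

/-- The operator of `sp(V, ω)` attached to a product of two vectors. -/
def symOperator {K U : Type*} [CommRing K] [AddCommGroup U] [Module K U]
    (B : LinearMap.BilinForm K U) : U →ₗ[K] U →ₗ[K] End K U :=
  LinearMap.mk₂ K (fun u v => (B u).smulRight v + (B v).smulRight u)
    (fun u u' v => by ext; simp [add_smul]; abel)
    (fun c u v => by ext; simp [mul_smul, smul_comm c])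
    (fun u v v' => by ext; simp [add_smul]; abel)
    (fun c u v => by ext; simp [mul_smul, smul_comm c])

theorem symOperator_apply {K U : Type*} [CommRing K] [AddCommGroup U] [Module K U]
    (B : LinearMap.BilinForm K U) (u v w : U) :
    symOperator B u v w = B u w • v + B v w • u := rfl

theorem symOperator_skew {K U : Type*} [CommRing K] [AddCommGroup U] [Module K U]
    {B : LinearMap.BilinForm K U} (hB : ∀ x y, -B x y = B y x) (u v x y : U) :
    B (symOperator B u v x) y = -B x (symOperator B u v y) := by
  simp only [symOperator_apply, map_add, LinearMap.add_apply, map_smul, LinearMap.smul_apply,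
    smul_eq_mul]
  rw [← hB u x, ← hB v x]
  ring

/-- Fix a nonzero `b` in `ker L`. For `u` in `ker L` the operator of the product `b · u` commutes
with `L`, both composites being zero, and multiplication by `b` is injective. -/
theorem finrank_ker_le_finrank_centralizer :
    finrank ℝ (LinearMap.ker S.vectorField) ≤ finrank ℝ S.centralizer := by
  by_cases hbot : LinearMap.ker S.vectorField = ⊥
  · rw [hbot, finrank_bot]
    exact Nat.zero_le _
  obtain ⟨b, hb, hb0⟩ := Submodule.exists_mem_ne_zero_of_ne_bot hbot
  have hz : ∀ u ∈ LinearMap.ker S.vectorField, ∀ x, S.ω u (S.vectorField x) = 0 := by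
    intro u hu x
    have := S.ω_vectorField_left u x
    rw [LinearMap.mem_ker.1 hu] at this
    simpa using this.symm
  have hmem : ∀ u ∈ LinearMap.ker S.vectorField, symOperator S.ω b u ∈ S.centralizer := by
    intro u hu
    rw [mem_centralizer]
    refine ⟨symOperator_skew S.isAlt.neg_eq b u, fun x => ?_⟩
    simp [symOperator_apply, hz _ hb, hz _ hu, LinearMap.mem_ker.1 hb, LinearMap.mem_ker.1 hu]
  refine LinearMap.finrank_le_finrank_of_injective
    (f := ((symOperator S.ω b).restrict hmem)) ?_
  rw [← LinearMap.ker_eq_bot, LinearMap.ker_eq_bot']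
  rintro ⟨u, hu⟩ h
  have key : ∀ x, S.ω b x • u + S.ω u x • b = 0 := fun x =>
    LinearMap.congr_fun (congrArg Subtype.val h) x
  obtain ⟨x, hx⟩ : ∃ x, S.ω b x ≠ 0 := by
    by_contra! hcon
    exact hb0 (S.nondegenerate.1 _ hcon)
  -- Where `ω b x ≠ 0` the vanishing operator makes `u` a multiple `k • b`; the operator is then `2k
  -- ω(b, ·) b`, so `k = 0`.
  obtain ⟨k, rfl⟩ : ∃ k : ℝ, u = k • b := by
    refine ⟨-(S.ω b x)⁻¹ * S.ω u x, ?_⟩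
    rw [mul_smul, eq_neg_of_add_eq_zero_right (key x), neg_smul, smul_neg, neg_neg, smul_smul,
      inv_mul_cancel₀ hx, one_smul]
  have h2 := key x
  rw [map_smul, LinearMap.smul_apply, smul_smul, ← add_smul, smul_eq_zero] at h2
  have h3 : k = 0 := by
    rcases h2 with h2 | h2
    · have : k * S.ω b x = 0 := by simp only [smul_eq_mul] at h2; linarith
      simpa [hx] using this
    · exact absurd h2 hb0
  simp [h3]

end LinearHamiltonianSystem

/-! ### Complex eigenvalues, and eigenvector products in the centralizer. -/

namespace LinearHamiltonianSystem

open Complexification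

variable {V : Type*} [AddCommGroup V] [Module ℝ V] [FiniteDimensional ℝ V]
  (S : LinearHamiltonianSystem V)

theorem baseChange_ω_skew (u v : ℂ ⊗[ℝ] V) :
    S.ω.baseChange ℂ (S.complexVectorField u) v =
      -S.ω.baseChange ℂ u (S.complexVectorField v) :=
  baseChange_skew S.ω_vectorField_left u v

theorem aeval_complexVectorField (p : ℝ[X]) :
    aeval S.complexVectorField p = (aeval S.vectorField p).baseChange ℂ :=
  aeval_algHom_apply (End.baseChangeHom ℝ ℂ V) S.vectorField p

theorem aeval_complexVectorField_sq (p : ℝ[X]) :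
    aeval (S.complexVectorField ^ 2) p = (aeval (S.vectorField ^ 2) p).baseChange ℂ := by
  have h := aeval_algHom_apply (End.baseChangeHom ℝ ℂ V) (S.vectorField ^ 2) p
  rw [map_pow] at h
  exact h

/-- As `L` is skew, the eigenspace of `-z` is the `ω`-orthogonal of the range of `L - z`. -/
theorem finrank_eigenspace_neg (z : ℂ) :
    finrank ℂ (S.complexVectorField.eigenspace (-z)) =
      finrank ℂ (S.complexVectorField.eigenspace z) := by
  have hnd := baseChange_nondegenerate S.isAlt S.nondegenerate
  have horth : (S.ω.baseChange ℂ).orthogonal (LinearMap.range (S.complexVectorField - z • 1)) =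
      S.complexVectorField.eigenspace (-z) := by
    ext v
    rw [LinearMap.BilinForm.mem_orthogonal_iff, End.mem_eigenspace_iff]
    have key : ∀ u, S.ω.baseChange ℂ ((S.complexVectorField - z • 1) u) v =
        -S.ω.baseChange ℂ u (S.complexVectorField v - (-z) • v) := by
      intro u
      simp only [LinearMap.sub_apply, LinearMap.smul_apply, End.one_apply, map_sub, map_smul,
        baseChange_ω_skew, smul_eq_mul]
      ring
    constructor
    · intro h
      rw [← sub_eq_zero]
      apply hnd.2
      intro u
      have := h _ ⟨u, rfl⟩
      rw [key] at this
      exact neg_eq_zero.1 this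
    · rintro h _ ⟨u, rfl⟩
      rw [key, h, sub_self, map_zero, neg_zero]
  have h₁ := LinearMap.BilinForm.finrank_orthogonal hnd
    (LinearMap.range (S.complexVectorField - z • 1))
  have h₂ := LinearMap.finrank_range_add_finrank_ker (S.complexVectorField - z • 1)
  rw [← End.eigenspace_def] at h₂
  rw [horth] at h₁
  omega

theorem mem_eigenvalues_iff_finrank {z : ℂ} :
    z ∈ S.eigenvalues ↔ 0 < finrank ℂ (S.complexVectorField.eigenspace z) := by
  rw [eigenvalues, Set.mem_ofPred_eq, End.hasEigenvalue_iff, Nat.pos_iff_ne_zero, Ne,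
    Ne, Submodule.finrank_eq_zero]

theorem neg_mem_eigenvalues {z : ℂ} (hz : z ∈ S.eigenvalues) : -z ∈ S.eigenvalues := by
  rw [mem_eigenvalues_iff_finrank] at hz ⊢
  rwa [finrank_eigenspace_neg]

theorem mem_eigenvalues_iff_aeval_charpoly {z : ℂ} :
    z ∈ S.eigenvalues ↔ aeval z S.vectorField.charpoly = 0 := by
  rw [eigenvalues, Set.mem_ofPred_eq, End.hasEigenvalue_iff_isRoot_charpoly, complexVectorField,
    LinearMap.charpoly_baseChange, IsRoot, eval_map_algebraMap]

theorem conj_mem_eigenvalues {z : ℂ} (hz : z ∈ S.eigenvalues) :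
    (starRingEnd ℂ) z ∈ S.eigenvalues := by
  rw [mem_eigenvalues_iff_aeval_charpoly] at hz ⊢
  rw [aeval_conj, hz, map_zero]

theorem quadruplet_subset_eigenvalues {z : ℂ} (hz : z ∈ S.eigenvalues) :
    quadruplet z ⊆ S.eigenvalues := by
  rintro w (rfl | rfl | rfl | rfl)
  · exact hz
  · exact S.neg_mem_eigenvalues hz
  · exact S.conj_mem_eigenvalues hz
  · exact S.neg_mem_eigenvalues (S.conj_mem_eigenvalues hz)

theorem finite_eigenvalues : S.eigenvalues.Finite :=
  End.finite_hasEigenvalue S.complexVectorField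

theorem exists_mem_eigenvalues [Nontrivial V] : ∃ z, z ∈ S.eigenvalues := by
  have : Nontrivial (ℂ ⊗[ℝ] V) := by
    apply Module.nontrivial_of_finrank_pos (R := ℂ)
    rw [Module.finrank_baseChange]
    exact Module.finrank_pos
  exact End.exists_eigenvalue S.complexVectorField

theorem aeval_eigenvalue_eq_zero {p : ℝ[X]} (hp : aeval S.vectorField p = 0) {z : ℂ}
    (hz : z ∈ S.eigenvalues) : aeval z p = 0 := by
  obtain ⟨u, hu⟩ := End.HasEigenvalue.exists_hasEigenvector hz
  have h := End.aeval_apply_of_hasEigenvector (p := p.map (algebraMap ℝ ℂ)) hu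
  rw [aeval_map_algebraMap, aeval_complexVectorField, hp, LinearMap.baseChange_zero,
    LinearMap.zero_apply, eq_comm, smul_eq_zero] at h
  simpa [eval_map_algebraMap] using h.resolve_right hu.2

theorem aeval_sq_eq (p : ℝ[X]) {R : Type*} [Ring R] [Algebra ℝ R] (x : R) :
    aeval x (p.comp (X ^ 2)) = aeval (x ^ 2) p := by
  rw [aeval_comp, map_pow, aeval_X]

theorem aeval_eigenvalue_sq_eq_zero {p : ℝ[X]} (hp : aeval (S.vectorField ^ 2) p = 0) {z : ℂ}
    (hz : z ∈ S.eigenvalues) : aeval (z ^ 2) p = 0 := by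
  rw [← aeval_sq_eq] at hp ⊢
  exact S.aeval_eigenvalue_eq_zero hp hz

/-- The real and imaginary parts of a complex eigenvector lie in this kernel and do not both vanish.
-/
theorem ker_aeval_sq_ne_bot {p : ℝ[X]} {z : ℂ} (hz : z ∈ S.eigenvalues)
    (hp : aeval (z ^ 2) p = 0) : LinearMap.ker (aeval (S.vectorField ^ 2) p) ≠ ⊥ := by
  intro hker
  obtain ⟨u, hu⟩ := End.HasEigenvalue.exists_hasEigenvector hz
  have h := End.aeval_apply_of_hasEigenvector (p := (p.comp (X ^ 2)).map (algebraMap ℝ ℂ)) hu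
  rw [aeval_map_algebraMap, eval_map_algebraMap, aeval_sq_eq, aeval_sq_eq, hp, zero_smul,
    aeval_complexVectorField_sq] at h
  rw [LinearMap.ker_eq_bot'] at hker
  apply hu.2
  apply ext_parts
  · rw [map_zero]
    apply hker
    rw [← rePart_baseChange, h, map_zero]
  · rw [map_zero]
    apply hker
    rw [← imPart_baseChange, h, map_zero]

/-- The characteristic polynomial has `dim V` complex roots, each a root of `f(X²)`, so it divides
`f(X²) ^ dim V`; Cayley–Hamilton concludes. -/
theorem aeval_sq_pow_finrank_eq_zero {f : ℝ[X]} (hf : ∀ z ∈ S.eigenvalues, aeval (z ^ 2) f = 0) :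
    aeval (S.vectorField ^ 2) (f ^ finrank ℝ V) = 0 := by
  set F := (f.comp (X ^ 2)).map (algebraMap ℝ ℂ) with hF
  set c := LinearMap.charpoly S.complexVectorField with hc
  have hsplit := IsAlgClosed.splits c
  have hdvd : c ∣ F ^ finrank ℝ V := by
    have h₁ : (c.roots.map fun a => X - C a).prod ∣ (c.roots.map fun _ => F).prod := by
      apply Multiset.prod_dvd_prod_of_dvd
      intro a ha
      rw [dvd_iff_isRoot, IsRoot, hF, eval_map_algebraMap, aeval_sq_eq]
      apply hf
      rw [eigenvalues, Set.mem_ofPred_eq, End.hasEigenvalue_iff_isRoot_charpoly]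
      exact isRoot_of_mem_roots ha
    rw [Multiset.map_const', Multiset.prod_replicate, ← hsplit.natDegree_eq_card_roots, hc,
      LinearMap.charpoly_natDegree, Module.finrank_baseChange] at h₁
    have h₂ := hsplit.eq_prod_roots
    rw [(LinearMap.charpoly_monic S.complexVectorField).leadingCoeff, C_1, one_mul] at h₂
    rwa [h₂]
  have h₃ : aeval S.complexVectorField (F ^ finrank ℝ V) = 0 := by
    obtain ⟨d, hd⟩ := hdvd
    rw [hd, map_mul, LinearMap.aeval_self_charpoly, zero_mul]
  rw [hF, ← Polynomial.map_pow, aeval_map_algebraMap, ← pow_comp, aeval_sq_eq,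
    aeval_complexVectorField_sq] at h₃
  apply baseChange_injective
  rw [map_zero]
  exact h₃

theorem ofReal_mem_eigenvalues {a : ℝ} {x : V} (hx : S.vectorField x = a • x) (h0 : x ≠ 0) :
    (a : ℂ) ∈ S.eigenvalues := by
  refine End.hasEigenvalue_of_hasEigenvector (x := (1 : ℂ) ⊗ₜ[ℝ] x) ⟨?_, ?_⟩
  · rw [End.mem_eigenspace_iff, complexVectorField, LinearMap.baseChange_tmul, hx,
      ← TensorProduct.smul_tmul, TensorProduct.smul_tmul']
    simp
  · intro h
    apply h0
    simpa using congrArg rePart h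

theorem exists_real_eigenvector {a : ℝ} (ha : (a : ℂ) ∈ S.eigenvalues) :
    ∃ x, x ≠ 0 ∧ S.vectorField x = a • x := by
  obtain ⟨u, hu⟩ := End.HasEigenvalue.exists_hasEigenvector ha
  have h := hu.apply_eq_smul
  rw [Complex.coe_smul, complexVectorField] at h
  have h₁ := congrArg rePart h
  have h₂ := congrArg imPart h
  rw [rePart_baseChange, map_smul] at h₁
  rw [imPart_baseChange, map_smul] at h₂
  by_cases h0 : rePart u = 0
  · refine ⟨imPart u, fun h0' => hu.2 (ext_parts ?_ ?_), h₂⟩ <;> simp [h0, h0']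
  · exact ⟨_, h0, h₁⟩

/-- A complex operator is in the complex centralizer if it is skew for the complexified form and
commutes with the complexified vector field. -/
def MemComplexCentralizer (B : End ℂ (ℂ ⊗[ℝ] V)) : Prop :=
  (∀ u v, S.ω.baseChange ℂ (B u) v = -S.ω.baseChange ℂ u (B v)) ∧
    ∀ u, B (S.complexVectorField u) = S.complexVectorField (B u)

theorem MemComplexCentralizer.add {S : LinearHamiltonianSystem V} {B B' : End ℂ (ℂ ⊗[ℝ] V)}
    (h : S.MemComplexCentralizer B) (h' : S.MemComplexCentralizer B') :
    S.MemComplexCentralizer (B + B') :=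
  ⟨fun u v => by
    rw [LinearMap.add_apply, LinearMap.add_apply, map_add, LinearMap.add_apply, h.1, h'.1, map_add]
    ring, fun u => by simp [h.2, h'.2]⟩

/-- Real and imaginary parts of an operator in the complex centralizer lie in the real one, and
determine the operator. This lets centralizer elements be built from complex eigenvectors. -/
theorem finrank_le_finrank_centralizer {E : Type*} [AddCommGroup E] [Module ℂ E]
    [FiniteDimensional ℂ E] (f : E →ₗ[ℂ] End ℂ (ℂ ⊗[ℝ] V)) (hinj : ∀ e, f e = 0 → e = 0)
    (hmem : ∀ e, S.MemComplexCentralizer (f e)) :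
    finrank ℂ E ≤ finrank ℝ S.centralizer := by
  have hre : ∀ B, S.MemComplexCentralizer B → reOperator B ∈ S.centralizer := by
    rintro B ⟨h₁, h₂⟩
    rw [mem_centralizer]
    refine ⟨fun x y => ?_, fun x => ?_⟩
    · rw [reOperator_apply, reOperator_apply, ← re_baseChange_tmul, h₁, Complex.neg_re,
        ← baseChange_neg_eq S.isAlt, Complex.neg_re, re_baseChange_tmul, neg_neg, ← S.isAlt.neg_eq]
    · rw [reOperator_apply, reOperator_apply, ← rePart_baseChange]
      congr 1
      rw [← LinearMap.baseChange_tmul]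
      exact h₂ _
  have him : ∀ B, S.MemComplexCentralizer B → imOperator B ∈ S.centralizer := by
    rintro B ⟨h₁, h₂⟩
    rw [mem_centralizer]
    refine ⟨fun x y => ?_, fun x => ?_⟩
    · rw [imOperator_apply, imOperator_apply, ← im_baseChange_tmul, h₁, Complex.neg_im,
        ← baseChange_neg_eq S.isAlt, Complex.neg_im, im_baseChange_tmul, neg_neg, ← S.isAlt.neg_eq]
    · rw [imOperator_apply, imOperator_apply, ← imPart_baseChange]
      congr 1
      rw [← LinearMap.baseChange_tmul]
      exact h₂ _
  let φ : E →ₗ[ℝ] S.centralizer × S.centralizer :=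
    { toFun := fun e => (⟨_, hre _ (hmem e)⟩, ⟨_, him _ (hmem e)⟩)
      map_add' := fun e e' => by ext <;> simp
      map_smul' := fun c e => by
        have : f (c • e) = c • f e := by
          rw [← Complex.coe_smul, map_smul]
          exact algebraMap_smul ℂ c (f e)
        ext <;> simp [this] }
  have hφ : Function.Injective φ := by
    rw [← LinearMap.ker_eq_bot, LinearMap.ker_eq_bot']
    intro e he
    apply hinj
    apply eq_zero_of_reOperator_imOperator
    · exact congrArg (fun p => (p.1 : End ℝ V)) he
    · exact congrArg (fun p => (p.2 : End ℝ V)) he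
  have h := LinearMap.finrank_le_finrank_of_injective hφ
  rw [finrank_real_of_complex, Module.finrank_prod] at h
  omega

/-- The commutator with `L` acts on the product `u · v` as a derivation, and the eigenvalues `z` and
`-z` add up to zero. -/
theorem memComplexCentralizer_symOperator {z : ℂ} {u v : ℂ ⊗[ℝ] V}
    (hu : S.complexVectorField u = z • u) (hv : S.complexVectorField v = (-z) • v) :
    S.MemComplexCentralizer (symOperator (S.ω.baseChange ℂ) u v) := by
  refine ⟨symOperator_skew (baseChange_neg_eq S.isAlt) u v, fun w => ?_⟩
  have h₁ := S.baseChange_ω_skew u w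
  have h₂ := S.baseChange_ω_skew v w
  rw [hu, map_smul, LinearMap.smul_apply, ← neg_eq_iff_eq_neg] at h₁
  rw [hv, map_smul, LinearMap.smul_apply, ← neg_eq_iff_eq_neg] at h₂
  rw [symOperator_apply, symOperator_apply, ← h₁, ← h₂, map_add, map_smul, map_smul, hu, hv]
  simp only [smul_eq_mul]
  module

/-- The eigenspace of `-z` contains two independent vectors `b₀`, `b₁`, and `(u₁, u₂) ↦ u₁ · b₀ + u₂
· b₁` embeds two copies of the eigenspace of `z` into the complex centralizer. -/
theorem two_mul_finrank_eigenspace_le {z : ℂ} (hz : z ≠ 0)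
    (h : 2 ≤ finrank ℂ (S.complexVectorField.eigenspace z)) :
    2 * finrank ℂ (S.complexVectorField.eigenspace z) ≤ finrank ℝ S.centralizer := by
  rw [← finrank_eigenspace_neg] at h
  obtain ⟨b, hb⟩ := exists_linearIndependent_of_le_finrank h
  have hlin : LinearIndependent ℂ (fun i => (b i : ℂ ⊗[ℝ] V)) :=
    hb.map' _ (Submodule.ker_subtype _)
  have hbi : ∀ i, S.complexVectorField (b i) = (-z) • (b i : ℂ ⊗[ℝ] V) := fun i =>
    End.mem_eigenspace_iff.1 (b i).2
  set E := S.complexVectorField.eigenspace z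
  let φ : (E × E) →ₗ[ℂ] End ℂ (ℂ ⊗[ℝ] V) :=
      ((symOperator (S.ω.baseChange ℂ)).flip (b 0) ∘ₗ E.subtype ∘ₗ LinearMap.fst ℂ E E +
        (symOperator (S.ω.baseChange ℂ)).flip (b 1) ∘ₗ E.subtype ∘ₗ LinearMap.snd ℂ E E)
  have hmem : ∀ p, S.MemComplexCentralizer (φ p) := fun p => MemComplexCentralizer.add
        (S.memComplexCentralizer_symOperator (End.mem_eigenspace_iff.1 p.1.2) (hbi 0))
        (S.memComplexCentralizer_symOperator (End.mem_eigenspace_iff.1 p.2.2) (hbi 1))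
  have hφ : ∀ p, φ p = 0 → p = 0 := by
    rintro ⟨⟨u₁, h₁⟩, ⟨u₂, h₂⟩⟩ hu
    have key : ∀ w, (S.ω.baseChange ℂ u₁ w • (b 0 : ℂ ⊗[ℝ] V) + S.ω.baseChange ℂ (b 0) w • u₁) +
        (S.ω.baseChange ℂ u₂ w • (b 1 : ℂ ⊗[ℝ] V) + S.ω.baseChange ℂ (b 1) w • u₂) = 0 :=
      fun w => LinearMap.congr_fun hu w
    have hdis : Disjoint E (S.complexVectorField.eigenspace (-z)) := by
      rw [Submodule.disjoint_def]
      intro x hx hx'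
      rw [End.mem_eigenspace_iff] at hx hx'
      rw [hx, neg_smul, eq_neg_iff_add_eq_zero, ← two_smul ℂ, smul_smul, smul_eq_zero] at hx'
      simpa [hz] using hx'
    -- The eigenspaces of `z` and `-z` are disjoint, so the components of the identity `key` in them
    -- vanish separately; independence of the `b i` kills the coefficients.
    have hzero : ∀ w, S.ω.baseChange ℂ u₁ w = 0 ∧ S.ω.baseChange ℂ u₂ w = 0 := by
      intro w
      set x := S.ω.baseChange ℂ u₁ w • (b 0 : ℂ ⊗[ℝ] V) +
        S.ω.baseChange ℂ u₂ w • (b 1 : ℂ ⊗[ℝ] V) with hx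
      have hxb : x ∈ S.complexVectorField.eigenspace (-z) :=
        Submodule.add_mem _ (Submodule.smul_mem _ _ (b 0).2) (Submodule.smul_mem _ _ (b 1).2)
      have hxE : x ∈ E := by
        have : x = -(S.ω.baseChange ℂ (b 0) w • u₁ + S.ω.baseChange ℂ (b 1) w • u₂) := by
          rw [eq_neg_iff_add_eq_zero, ← key w, hx]
          abel
        rw [this]
        exact Submodule.neg_mem _
          (Submodule.add_mem _ (Submodule.smul_mem _ _ h₁) (Submodule.smul_mem _ _ h₂))
      have hx0 : x = 0 := Submodule.disjoint_def.1 hdis x hxE hxb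
      have := Fintype.linearIndependent_iff.1 hlin
        ![S.ω.baseChange ℂ u₁ w, S.ω.baseChange ℂ u₂ w] (by simpa [Fin.sum_univ_two] using hx0)
      exact ⟨by simpa using this 0, by simpa using this 1⟩
    have e₁ : u₁ = 0 := eq_zero_of_baseChange_eq_zero S.nondegenerate fun w => (hzero w).1
    have e₂ : u₂ = 0 := eq_zero_of_baseChange_eq_zero S.nondegenerate fun w => (hzero w).2
    ext1 <;> ext1 <;> assumption
  have := S.finrank_le_finrank_centralizer φ hφ hmem
  rw [Module.finrank_prod] at this
  omega

end LinearHamiltonianSystem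

/-! ### Quadruplets and the minimal polynomial of the squared eigenvalue. -/

namespace LinearHamiltonianSystem

/-- The minimal polynomial over `ℝ` of the square of a complex number. -/
def sqPoly (z : ℂ) : ℝ[X] := minpoly ℝ (z ^ 2)

theorem sqPoly_monic (z : ℂ) : (sqPoly z).Monic := minpoly.monic (IsIntegral.of_finite ℝ _)

theorem sqPoly_irreducible (z : ℂ) : Irreducible (sqPoly z) :=
  minpoly.irreducible (IsIntegral.of_finite ℝ _)

theorem aeval_sqPoly_self (z : ℂ) : aeval (z ^ 2) (sqPoly z) = 0 := minpoly.aeval _ _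

theorem mem_quadruplet_self (z : ℂ) : z ∈ quadruplet z := Or.inl rfl

theorem aeval_quadratic (z u : ℂ) :
    aeval u (X ^ 2 - C (2 * z.re) * X + C (Complex.normSq z) : ℝ[X]) =
      (u - z) * (u - (starRingEnd ℂ) z) := by
  have h₂ : ((2 * z.re : ℝ) : ℂ) = z + (starRingEnd ℂ) z := by rw [Complex.add_conj]
  rw [map_add, map_sub, map_mul, map_pow, aeval_X, aeval_C, aeval_C, Complex.coe_algebraMap,
    ← Complex.mul_conj, h₂]
  ring

theorem sqPoly_dvd_quadratic (z : ℂ) :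
    sqPoly z ∣ X ^ 2 - C (2 * (z ^ 2).re) * X + C (Complex.normSq (z ^ 2)) :=
  minpoly.dvd _ _ (by rw [aeval_quadratic, sub_self, zero_mul])

/-- The polynomial divides `(X - z²)(X - z̄²)`, and the square roots of `z²` and `z̄²` form the
quadruplet. -/
theorem aeval_sqPoly_eq_zero_iff {z w : ℂ} :
    aeval (w ^ 2) (sqPoly z) = 0 ↔ w ∈ quadruplet z := by
  constructor
  · intro h
    have h₀ := aeval_eq_zero_of_dvd_aeval_eq_zero (sqPoly_dvd_quadratic z) h
    rw [aeval_quadratic, mul_eq_zero, sub_eq_zero, sub_eq_zero, map_pow, sq_eq_sq_iff_eq_or_eq_neg,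
      sq_eq_sq_iff_eq_or_eq_neg] at h₀
    simp only [quadruplet, Set.mem_insert_iff, Set.mem_singleton_iff]
    tauto
  · rintro (rfl | rfl | rfl | rfl)
    · exact aeval_sqPoly_self _
    · rw [neg_sq]
      exact aeval_sqPoly_self _
    · rw [← map_pow, aeval_conj, aeval_sqPoly_self, map_zero]
    · rw [neg_sq, ← map_pow, aeval_conj, aeval_sqPoly_self, map_zero]

theorem sqPoly_eq_of_mem_quadruplet {z w : ℂ} (h : w ∈ quadruplet z) : sqPoly w = sqPoly z :=
  (minpoly.eq_of_irreducible_of_monic (sqPoly_irreducible z) (aeval_sqPoly_eq_zero_iff.2 h)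
    (sqPoly_monic z)).symm

theorem quadruplet_eq_of_sqPoly_eq {z w : ℂ} (h : sqPoly z = sqPoly w) :
    quadruplet z = quadruplet w := by
  ext u
  rw [← aeval_sqPoly_eq_zero_iff, ← aeval_sqPoly_eq_zero_iff, h]

theorem isCoprime_sqPoly {z w : ℂ} (h : quadruplet z ≠ quadruplet w) :
    IsCoprime (sqPoly z) (sqPoly w) := by
  rw [(sqPoly_irreducible z).coprime_iff_not_dvd]
  intro hdvd
  apply h
  apply quadruplet_eq_of_sqPoly_eq
  exact eq_of_monic_of_associated (sqPoly_monic z) (sqPoly_monic w)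
    ((sqPoly_irreducible z).associated_of_dvd (sqPoly_irreducible w) hdvd)

theorem natDegree_sqPoly_pos (z : ℂ) : 0 < (sqPoly z).natDegree :=
  minpoly.natDegree_pos (IsIntegral.of_finite ℝ _)

theorem natDegree_sqPoly_le (z : ℂ) : (sqPoly z).natDegree ≤ 2 := by
  have := minpoly.natDegree_le (A := ℝ) (z ^ 2)
  rwa [Complex.finrank_real_complex] at this

theorem sqPoly_eq_of_real {z : ℂ} {c : ℝ} (h : z ^ 2 = c) : sqPoly z = X - C c := by
  rw [sqPoly, h]
  exact minpoly.eq_X_sub_C ℂ c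

theorem exists_sq_eq_ofReal {z : ℂ} (h : z.re = 0 ∨ z.im = 0) : ∃ c : ℝ, z ^ 2 = c := by
  refine ⟨(z ^ 2).re, ?_⟩
  apply Complex.ext
  · simp
  · rcases h with h | h <;> simp [pow_two, h]

theorem natDegree_sqPoly_of_generic {z : ℂ} (hre : z.re ≠ 0) (him : z.im ≠ 0) :
    (sqPoly z).natDegree = 2 := by
  have h₁ := natDegree_sqPoly_pos z
  have h₂ := natDegree_sqPoly_le z
  have h₃ : (sqPoly z).natDegree ≠ 1 := by
    intro h
    rw [sqPoly, minpoly.natDegree_eq_one_iff] at h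
    obtain ⟨c, hc⟩ := h
    have := congrArg Complex.im hc
    simp only [Complex.coe_algebraMap, Complex.ofReal_im, pow_two, Complex.mul_im] at this
    have h0 : z.re * z.im = 0 := by linarith
    simp [hre, him] at h0
  omega

/-- The number of elements of a quadruplet in the open right half plane or the open positive
imaginary half axis. -/
def quadrupletModuli (z : ℂ) : ℕ :=
  {w ∈ quadruplet z | 0 < w.re ∨ (w.re = 0 ∧ 0 < w.im)}.ncard

theorem finite_quadruplet (z : ℂ) : (quadruplet z).Finite := by
  simp [quadruplet]

theorem quadruplet_zero : quadruplet 0 = {0} := by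
  simp [quadruplet]

theorem zero_notMem_quadruplet {z : ℂ} (hz : z ≠ 0) : 0 ∉ quadruplet z := by
  simp only [quadruplet, Set.mem_insert_iff, Set.mem_singleton_iff, zero_eq_neg, map_eq_zero, hz,
    hz.symm, false_or, not_or]
  have : (starRingEnd ℂ) z ≠ 0 := by simpa using hz
  exact ⟨this.symm, by simp⟩

theorem quadrupletModuli_zero : quadrupletModuli 0 = 0 := by
  rw [quadrupletModuli, quadruplet_zero, Set.ncard_eq_zero ((Set.finite_singleton _).sep _)]
  ext w
  simp only [Set.mem_singleton_iff, Set.mem_empty_iff_false, iff_false]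
  rintro ⟨rfl, h⟩
  simp at h

/-- Squaring sends the counted elements to roots of `sqPoly z`; it is injective on them because `w`
and `-w` are never both counted. -/
theorem quadrupletModuli_le (z : ℂ) : quadrupletModuli z ≤ (sqPoly z).natDegree := by
  have hne : (sqPoly z).map (algebraMap ℝ ℂ) ≠ 0 := ((sqPoly_monic z).map _).ne_zero
  calc quadrupletModuli z ≤ (((sqPoly z).map (algebraMap ℝ ℂ)).roots.toFinset : Set ℂ).ncard := by
        refine Set.ncard_le_ncard_of_injOn (fun w => w ^ 2) ?_ ?_ (Finset.finite_toSet _)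
        · rintro w ⟨hw, -⟩
          simp only [Finset.mem_coe, Multiset.mem_toFinset]
          rw [mem_roots hne, IsRoot, eval_map_algebraMap]
          exact aeval_sqPoly_eq_zero_iff.2 hw
        · rintro w ⟨-, hw⟩ v ⟨-, hv⟩ h
          rcases sq_eq_sq_iff_eq_or_eq_neg.1 h with h | h
          · exact h
          · exfalso
            subst h
            simp only [Complex.neg_re, Complex.neg_im] at hw
            rcases hw with hw | hw <;> rcases hv with hv | hv <;> linarith [hw, hv]
    _ ≤ (sqPoly z).natDegree := by
        rw [Set.ncard_coe_finset]
        refine (Multiset.toFinset_card_le _).trans ((card_roots' _).trans ?_)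
        exact natDegree_map_le

variable {V : Type*} [AddCommGroup V] [Module ℝ V] [FiniteDimensional ℝ V]
  (S : LinearHamiltonianSystem V)

theorem finrank_pos_of_mem_eigenvalues {z : ℂ} (hz : z ∈ S.eigenvalues) : 0 < finrank ℝ V := by
  rw [mem_eigenvalues_iff_finrank] at hz
  rw [← Module.finrank_baseChange (R := ℂ)]
  exact hz.trans_le (Submodule.finrank_le _)

theorem ker_vectorField_eq_bot (h0 : (0 : ℂ) ∉ S.eigenvalues) :
    LinearMap.ker S.vectorField = ⊥ := by
  rw [LinearMap.ker_eq_bot']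
  intro x hx
  by_contra hne
  apply h0
  have := S.ofReal_mem_eigenvalues (a := 0) (by rw [hx, zero_smul]) hne
  simpa using this

theorem aeval_sq_commute (p : ℝ[X]) (x : V) :
    aeval (S.vectorField ^ 2) p (S.vectorField x) =
      S.vectorField (aeval (S.vectorField ^ 2) p x) := by
  rw [← aeval_sq_eq, ← End.mul_apply, ← End.mul_apply]
  congr 1
  have h := congrArg (aeval S.vectorField) (mul_comm (p.comp (X ^ 2)) X)
  simpa only [map_mul, aeval_X] using h

/-- Odd polynomials in `L` are skew and commute with `L`. The operators `L (L²)^i`, for `i` below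
the degree, are independent because `L` is injective. -/
theorem natDegree_minpoly_sq_le (h : LinearMap.ker S.vectorField = ⊥) :
    (minpoly ℝ (S.vectorField ^ 2)).natDegree ≤ finrank ℝ S.centralizer := by
  have hmem : ∀ i : ℕ, S.vectorField * (S.vectorField ^ 2) ^ i ∈ S.centralizer := by
    intro i
    have hi : (S.vectorField ^ 2) ^ i = aeval (S.vectorField ^ 2) (X ^ i : ℝ[X]) := by simp
    rw [mem_centralizer, hi]
    refine ⟨fun x y => ?_, fun x => ?_⟩
    · rw [End.mul_apply, End.mul_apply, ω_vectorField_left, ω_aeval_sq_left, aeval_sq_commute]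
    · rw [End.mul_apply, End.mul_apply, aeval_sq_commute]
  have hlin : LinearIndependent ℝ
      (fun i : Fin (minpoly ℝ (S.vectorField ^ 2)).natDegree =>
        (⟨_, hmem i⟩ : S.centralizer)) := by
    apply LinearIndependent.of_comp S.centralizer.subtype
    refine (linearIndependent_pow (S.vectorField ^ 2)).map' (LinearMap.mulLeft ℝ S.vectorField) ?_
    rw [LinearMap.ker_eq_bot'] at h ⊢
    intro B hB
    ext x
    exact h _ (LinearMap.congr_fun hB x)
  simpa using hlin.fintype_card_le_finrank

/-- Over `ℂ`, `p(L²)` is a polynomial in `L` of degree `2 deg p`, and geometric simplicity lets each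
root add at most one dimension to the kernel. -/
theorem finrank_ker_aeval_sq_le (hg : ∀ z, finrank ℂ (S.complexVectorField.eigenspace z) ≤ 1)
    {p : ℝ[X]} (hp : p ≠ 0) :
    finrank ℝ (LinearMap.ker (aeval (S.vectorField ^ 2) p)) ≤ 2 * p.natDegree := by
  refine (Complexification.finrank_ker_le _).trans ?_
  rw [← aeval_complexVectorField_sq, ← aeval_sq_eq, ← aeval_map_algebraMap ℂ]
  have hdeg : ((p.comp (X ^ 2)).map (algebraMap ℝ ℂ)).natDegree = 2 * p.natDegree := by
    rw [natDegree_map, natDegree_comp, natDegree_X_pow, mul_comm]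
  rw [← hdeg]
  refine End.finrank_le_natDegree_of_finrank_eigenspace_le_one _ ?_ fun z _ => hg z
  rw [Ne, Polynomial.map_eq_zero]
  rw [← expand_eq_comp_X_pow]
  exact (expand_ne_zero two_pos).2 hp

theorem exists_minpoly_sq_eq {z : ℂ} (hS : S.eigenvalues = quadruplet z) :
    ∃ k, minpoly ℝ (S.vectorField ^ 2) = sqPoly z ^ k ∧ 0 < k := by
  have h : aeval (S.vectorField ^ 2) (sqPoly z ^ finrank ℝ V) = 0 :=
    S.aeval_sq_pow_finrank_eq_zero fun w hw => by
      rw [aeval_sqPoly_eq_zero_iff, ← hS]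
      exact hw
  have hdvd := minpoly.dvd ℝ _ h
  obtain ⟨k, -, hk⟩ := (dvd_prime_pow (sqPoly_irreducible z).prime _).1 hdvd
  have hm : (minpoly ℝ (S.vectorField ^ 2)).Monic :=
    minpoly.monic (IsIntegral.of_finite ℝ _)
  have heq := eq_of_monic_of_associated hm ((sqPoly_monic z).pow k) hk
  refine ⟨k, heq, Nat.pos_of_ne_zero ?_⟩
  rintro rfl
  have h1 : aeval (S.vectorField ^ 2) (1 : ℝ[X]) = 0 := by
    rw [← pow_zero (sqPoly z), ← heq, minpoly.aeval]
  have := S.aeval_eigenvalue_sq_eq_zero h1 (hS ▸ mem_quadruplet_self z)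
  simp at this

theorem natDegree_sqPoly_le_finrank_centralizer {z : ℂ} (hS : S.eigenvalues = quadruplet z)
    (hz : z ≠ 0) : (sqPoly z).natDegree ≤ finrank ℝ S.centralizer := by
  obtain ⟨k, hk, hk0⟩ := S.exists_minpoly_sq_eq hS
  have hker := S.ker_vectorField_eq_bot (by rw [hS]; exact zero_notMem_quadruplet hz)
  have := S.natDegree_minpoly_sq_le hker
  rw [hk, natDegree_pow] at this
  nlinarith

end LinearHamiltonianSystem

/-! ### Structure of a single block with a small centralizer. -/

theorem Polynomial.eq_zero_of_aeval_eq_zero_of_isCoprime {K V : Type*} [Field K] [AddCommGroup V]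
    [Module K V] (f : End K V) {p q : K[X]} (h : IsCoprime p q) {x : V}
    (hp : aeval f p x = 0) (hq : aeval f q x = 0) : x = 0 := by
  obtain ⟨a, b, hab⟩ := h
  have := LinearMap.congr_fun (congrArg (aeval f) hab) x
  simpa [hp, hq] using this.symm

theorem Polynomial.aeval_coe_of_coe {K V : Type*} [Field K] [AddCommGroup V] [Module K V]
    {f : End K V} {W : Submodule K V} {g : End K W} (h : ∀ y : W, f y = g y) (p : K[X]) (y : W) :
    aeval f p (y : V) = aeval g p y := by
  induction p using Polynomial.induction_on' generalizing y with
  | add p q hp hq => simp [hp, hq]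
  | monomial n a =>
    simp only [aeval_monomial, Module.End.mul_apply, Module.algebraMap_end_apply,
      Submodule.coe_smul]
    congr 1
    induction n generalizing y with
    | zero => simp
    | succ n ih => rw [pow_succ, pow_succ, End.mul_apply, End.mul_apply, h, ih]

namespace LinearHamiltonianSystem

variable {V : Type*} [AddCommGroup V] [Module ℝ V] [FiniteDimensional ℝ V]
  (S : LinearHamiltonianSystem V)

theorem isCoprime_X_sub_C_pow {z : ℂ} (hz : z ≠ 0) (m n : ℕ) :
    IsCoprime ((X - C z) ^ m) ((X - C (-z)) ^ n) := by
  apply IsCoprime.pow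
  apply isCoprime_X_sub_C_of_isUnit_sub
  rw [isUnit_iff_ne_zero, sub_neg_eq_add, ← two_mul]
  simpa using hz

/-- Since `(L - z)² (L + z)² = 0` with coprime factors, the generalized eigenspace lies in `ker (L -
z)²`, of dimension at most 2 by geometric simplicity. -/
theorem algMultiplicity_le_two {z : ℂ} {c : ℝ} (hz : z ≠ 0) (hzc : z ^ 2 = c)
    (hg : ∀ w, finrank ℂ (S.complexVectorField.eigenspace w) ≤ 1)
    (hT : aeval (S.vectorField ^ 2) ((X - C c) ^ 2) = 0) : S.algMultiplicity z ≤ 2 := by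
  rw [algMultiplicity, ← LinearMap.finrank_maxGenEigenspace_eq]
  have hmul : aeval S.complexVectorField ((X - C (-z)) ^ 2 * (X - C z) ^ 2) = 0 := by
    have h : ((X - C (-z)) ^ 2 * (X - C z) ^ 2 : ℂ[X]) =
        (((X - C c) ^ 2 : ℝ[X]).comp (X ^ 2)).map (algebraMap ℝ ℂ) := by
      have hc : (C (c : ℂ) : ℂ[X]) = C z ^ 2 := by rw [← C_pow, hzc]
      simp only [Polynomial.pow_comp, sub_comp, X_comp, C_comp, Polynomial.map_pow,
        Polynomial.map_sub, map_X, map_C, Complex.coe_algebraMap, hc, map_neg]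
      ring
    rw [h, aeval_map_algebraMap, aeval_sq_eq, aeval_complexVectorField_sq, hT,
      LinearMap.baseChange_zero]
  have hle : S.complexVectorField.maxGenEigenspace z ≤
      LinearMap.ker (aeval S.complexVectorField ((X - C z) ^ 2)) := by
    intro u hu
    obtain ⟨k, hk⟩ := End.mem_maxGenEigenspace _ _ _ |>.1 hu
    have hk' : aeval S.complexVectorField ((X - C z) ^ k) u = 0 := by
      rw [← hk]
      simp [Algebra.algebraMap_eq_smul_one]
    rw [LinearMap.mem_ker]
    apply Polynomial.eq_zero_of_aeval_eq_zero_of_isCoprime S.complexVectorField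
      (isCoprime_X_sub_C_pow hz k 2)
    · rw [← End.mul_apply, ← map_mul, mul_comm, map_mul, End.mul_apply, hk', map_zero]
    · rw [← End.mul_apply, ← map_mul, hmul, LinearMap.zero_apply]
  refine (Submodule.finrank_mono hle).trans ?_
  have h := End.finrank_le_natDegree_of_finrank_eigenspace_le_one S.complexVectorField
    (p := (X - C z) ^ 2) (pow_ne_zero _ (X_sub_C_ne_zero z)) fun w _ => hg w
  rwa [natDegree_pow, natDegree_X_sub_C, mul_one] at h

/-- For real or imaginary `z` the quadruplet reduces to `{z, -z}`. In dimension 4 this turns the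
upper bound 2 for each multiplicity into an equality. -/
theorem algMultiplicity_add_neg {z : ℂ} (hz : z ≠ 0) (hS : S.eigenvalues = quadruplet z)
    (hz' : z.re = 0 ∨ z.im = 0) :
    S.algMultiplicity z + S.algMultiplicity (-z) = finrank ℝ V := by
  classical
  set c := LinearMap.charpoly S.complexVectorField with hc
  have hcard : Multiset.card c.roots = finrank ℝ V := by
    rw [← (IsAlgClosed.splits c).natDegree_eq_card_roots, hc, LinearMap.charpoly_natDegree,
      Module.finrank_baseChange]
  have hmem : ∀ w ∈ c.roots, w ∈ ({z, -z} : Finset ℂ) := by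
    intro w hw
    have hw' : w ∈ quadruplet z := by
      rw [← hS, eigenvalues, Set.mem_ofPred_eq, End.hasEigenvalue_iff_isRoot_charpoly]
      exact isRoot_of_mem_roots hw
    have hconj : (starRingEnd ℂ) z = z ∨ (starRingEnd ℂ) z = -z := by
      rcases hz' with h | h
      · right
        apply Complex.ext <;> simp [h]
      · left
        apply Complex.ext <;> simp [h]
    simp only [Finset.mem_insert, Finset.mem_singleton]
    simp only [quadruplet, Set.mem_insert_iff, Set.mem_singleton_iff] at hw'
    rcases hconj with h | h
    · rw [h] at hw'
      tauto
    · rw [h, neg_neg] at hw'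
      tauto
  have hne : z ≠ -z := by
    intro h
    rw [eq_neg_iff_add_eq_zero, ← two_mul] at h
    simp [hz] at h
  rw [← hcard, ← Multiset.sum_count_eq_card hmem, Finset.sum_pair hne, count_roots, count_roots]
  rfl

theorem four_le_finrank_of_generic {z : ℂ} (hre : z.re ≠ 0) (him : z.im ≠ 0)
    (hS : S.eigenvalues = quadruplet z) : 4 ≤ finrank ℝ V := by
  classical
  set c := LinearMap.charpoly S.complexVectorField with hc
  have hcard : ({z, -z, (starRingEnd ℂ) z, -(starRingEnd ℂ) z} : Finset ℂ).card = 4 := by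
    have h₁ : ∀ r : ℝ, r ≠ 0 → r ≠ -r := fun r hr h => hr (by linarith)
    have h₂ := h₁ _ hre
    have h₃ := h₁ _ him
    rw [Finset.card_insert_of_notMem, Finset.card_insert_of_notMem, Finset.card_insert_of_notMem,
      Finset.card_singleton] <;>
    simp [Complex.ext_iff, h₂, h₃, h₂.symm, h₃.symm]
  have hsub : ({z, -z, (starRingEnd ℂ) z, -(starRingEnd ℂ) z} : Finset ℂ) ⊆ c.roots.toFinset := by
    intro w hw
    have hw' : w ∈ S.eigenvalues := by
      rw [hS]
      simpa [quadruplet] using hw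
    rw [eigenvalues, Set.mem_ofPred_eq, End.hasEigenvalue_iff_isRoot_charpoly] at hw'
    rw [Multiset.mem_toFinset, mem_roots (LinearMap.charpoly_monic _).ne_zero]
    exact hw'
  have h := (Finset.card_le_card hsub).trans
    ((Multiset.toFinset_card_le _).trans (card_roots' _))
  rwa [hcard, hc, LinearMap.charpoly_natDegree, Module.finrank_baseChange] at h

/-- The structure of a system with a single quadruplet of eigenvalues whose centralizer is small. -/
structure IsSimpleBlock (z : ℂ) : Prop where
  eigenvalues_eq : S.eigenvalues = quadruplet z
  ne_zero : z ≠ 0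
  finrank_eq : finrank ℝ V = 2 ∨ finrank ℝ V = 4
  finrank_eigenspace_le : ∀ w, finrank ℂ (S.complexVectorField.eigenspace w) ≤ 1
  of_finrank_two : finrank ℝ V = 2 → z.re = 0 ∨ z.im = 0
  aeval_generic : z.re ≠ 0 → z.im ≠ 0 → aeval (S.vectorField ^ 2) (sqPoly z) = 0
  aeval_sq : aeval (S.vectorField ^ 2) (sqPoly z ^ 2) = 0

/-- Let `d`, equal to 1 or 2, be the degree of `sqPoly z`. The minimal polynomial of `L²` is `sqPoly
z ^ k` with `k d ≤ d + 1`, so `k ≤ 2` if `d = 1` and `k = 1` if `d = 2`. Geometric simplicity gives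
`dim V ≤ 2 k d ≤ 4`. -/
theorem isSimpleBlock_of_finrank_centralizer_le {z : ℂ} (hS : S.eigenvalues = quadruplet z)
    (hz : z ≠ 0) (hC : finrank ℝ S.centralizer ≤ (sqPoly z).natDegree + 1) :
    S.IsSimpleBlock z := by
  have hdpos := natDegree_sqPoly_pos z
  have hdle := natDegree_sqPoly_le z
  have h0 : (0 : ℂ) ∉ S.eigenvalues := by rw [hS]; exact zero_notMem_quadruplet hz
  have hker := S.ker_vectorField_eq_bot h0
  have hg : ∀ w, finrank ℂ (S.complexVectorField.eigenspace w) ≤ 1 := by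
    intro w
    -- A multiple eigenvalue would give a centralizer of dimension at least 4, against `d + 1 ≤ 3`.
    by_contra! hw
    have hw0 : w ≠ 0 := by
      rintro rfl
      exact h0 (S.mem_eigenvalues_iff_finrank.2 (by omega))
    have := S.two_mul_finrank_eigenspace_le hw0 hw
    omega
  obtain ⟨k, hk, hk0⟩ := S.exists_minpoly_sq_eq hS
  have hkd := S.natDegree_minpoly_sq_le hker
  rw [hk, natDegree_pow] at hkd
  have haev : aeval (S.vectorField ^ 2) (sqPoly z ^ k) = 0 := by rw [← hk, minpoly.aeval]
  have hk2 : k ≤ 2 := by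
    by_contra! h
    nlinarith
  have hk1 : (sqPoly z).natDegree = 2 → k = 1 := by
    intro h
    rw [h] at hkd hC
    omega
  have hV : finrank ℝ V ≤ 4 := by
    have h := S.finrank_ker_aeval_sq_le hg (pow_ne_zero k (sqPoly_monic z).ne_zero)
    rw [haev, LinearMap.ker_zero, finrank_top, natDegree_pow] at h
    rcases (by omega : (sqPoly z).natDegree = 1 ∨ (sqPoly z).natDegree = 2) with hd | hd
    · rw [hd] at h
      omega
    · rw [hd, hk1 hd] at h
      omega
  have hVpos := S.finrank_pos_of_mem_eigenvalues (hS ▸ mem_quadruplet_self z)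
  have hVeven := S.even_finrank
  have hVeq : finrank ℝ V = 2 ∨ finrank ℝ V = 4 := by
    obtain ⟨r, hr⟩ := hVeven
    omega
  refine ⟨hS, hz, hVeq, hg, fun h2 => ?_, fun hre him => ?_, ?_⟩
  · by_contra! hcon
    have := S.four_le_finrank_of_generic hcon.1 hcon.2 hS
    omega
  · rwa [hk1 (natDegree_sqPoly_of_generic hre him), pow_one] at haev
  · have hsplit : sqPoly z ^ 2 = sqPoly z ^ k * sqPoly z ^ (2 - k) := by
      rw [← pow_add]
      congr 1
      omega
    rw [hsplit, map_mul, haev, zero_mul]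

namespace IsSimpleBlock

variable {S} {z : ℂ}

theorem geomMultiplicity_eq (h : S.IsSimpleBlock z) : S.geomMultiplicity z = 1 := by
  have h₁ := h.finrank_eigenspace_le z
  have h₂ := S.mem_eigenvalues_iff_finrank.1 (h.eigenvalues_eq ▸ mem_quadruplet_self z)
  rw [geomMultiplicity]
  omega

theorem algMultiplicity_eq (h : S.IsSimpleBlock z) (h4 : finrank ℝ V = 4)
    (hz : z.re = 0 ∨ z.im = 0) :
    S.algMultiplicity z = 2 := by
  obtain ⟨c, hc⟩ := exists_sq_eq_ofReal hz
  have hT := h.aeval_sq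
  rw [sqPoly_eq_of_real hc] at hT
  have h₁ := S.algMultiplicity_le_two h.ne_zero hc h.finrank_eigenspace_le hT
  have h₂ := S.algMultiplicity_le_two (neg_ne_zero.2 h.ne_zero) (by rwa [neg_sq])
    h.finrank_eigenspace_le hT
  have h₃ := S.algMultiplicity_add_neg h.ne_zero h.eigenvalues_eq hz
  omega

end IsSimpleBlock

end LinearHamiltonianSystem

/-! ### Splittings: projections, centralizers and the codimension bound. -/

namespace LinearHamiltonianSystem

variable {V : Type*} [AddCommGroup V] [Module ℝ V] [FiniteDimensional ℝ V]
  {S : LinearHamiltonianSystem V} {r : ℕ} (D : S.Splitting r)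

namespace Splitting

/-- A split system is isomorphic to the direct sum of its components. -/
def directSumEquiv : (DirectSum (Fin r) fun j => D.comp j) ≃ₗ[ℝ] V :=
  LinearEquiv.ofBijective (DirectSum.coeLinearMap D.comp) D.isInternal

theorem directSumEquiv_of (j : Fin r) (x : D.comp j) :
    D.directSumEquiv (DirectSum.of (fun j => D.comp j) j x) = x :=
  DirectSum.coeLinearMap_of D.comp j x

/-- The projection of a split system to a component. -/
def proj (j : Fin r) : V →ₗ[ℝ] D.comp j :=
  DirectSum.component ℝ (Fin r) (fun j => D.comp j) j ∘ₗ D.directSumEquiv.symm.toLinearMap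

theorem proj_apply (j : Fin r) (x : V) : D.proj j x = D.directSumEquiv.symm x j := rfl

theorem sum_proj (x : V) : ∑ j, (D.proj j x : V) = x := by
  obtain ⟨y, rfl⟩ := D.directSumEquiv.surjective x
  conv_rhs => rw [← DirectSum.sum_univ_of y, map_sum]
  refine Finset.sum_congr rfl fun j _ => ?_
  rw [directSumEquiv_of, proj_apply, LinearEquiv.symm_apply_apply]

theorem directSumEquiv_symm_coe (j : Fin r) (x : D.comp j) :
    D.directSumEquiv.symm (x : V) = DirectSum.of (fun j => D.comp j) j x := by
  rw [LinearEquiv.symm_apply_eq, directSumEquiv_of]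

theorem proj_coe (j : Fin r) (x : D.comp j) : D.proj j x = x := by
  rw [proj_apply, directSumEquiv_symm_coe, DirectSum.of_eq_same]

theorem proj_coe_of_ne {i j : Fin r} (hij : i ≠ j) (x : D.comp j) : D.proj i x = 0 := by
  rw [proj_apply, directSumEquiv_symm_coe, DirectSum.of_eq_of_ne _ _ _ hij]

theorem proj_sum_coe (x : ∀ j, D.comp j) (i : Fin r) : D.proj i (∑ j, (x j : V)) = x i := by
  rw [map_sum, Finset.sum_eq_single i, proj_coe]
  · intro j _ hj
    exact D.proj_coe_of_ne hj.symm _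
  · simp

theorem ω_coe_right (j : Fin r) (x : V) (y : D.comp j) :
    S.ω x y = (D.subsystem j).ω (D.proj j x) y := by
  conv_lhs => rw [← D.sum_proj x, map_sum, LinearMap.sum_apply]
  rw [Finset.sum_eq_single j]
  · rfl
  · intro i _ hi
    exact D.ω_eq_zero i j hi _ (D.proj i x).2 _ y.2
  · simp

theorem ω_eq_sum (x y : V) :
    S.ω x y = ∑ j, (D.subsystem j).ω (D.proj j x) (D.proj j y) := by
  conv_lhs => rw [← D.sum_proj y, map_sum]
  exact Finset.sum_congr rfl fun j _ => D.ω_coe_right j x _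

theorem associated_coe_right (j : Fin r) (x : V) (y : D.comp j) :
    QuadraticMap.associated (R := ℝ) S.H x y =
      QuadraticMap.associated (R := ℝ) (D.subsystem j).H (D.proj j x) y := by
  conv_lhs => rw [← D.sum_proj x, map_sum, LinearMap.sum_apply]
  rw [Finset.sum_eq_single j]
  · exact (LinearMap.congr_fun₂ (QuadraticMap.associated_comp ℝ S.H (D.comp j).subtype)
      (D.proj j x) y).symm
  · intro i _ hi
    rw [QuadraticMap.associated_isOrtho]
    exact D.H_add i j hi _ (D.proj i x).2 _ y.2
  · simp

theorem vectorField_coe (j : Fin r) (y : D.comp j) :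
    S.vectorField y = (D.subsystem j).vectorField y := by
  rw [← sub_eq_zero]
  apply S.nondegenerate.2
  intro x
  rw [map_sub, ω_vectorField, ω_coe_right, associated_coe_right, ω_vectorField, sub_self]

theorem proj_vectorField (j : Fin r) (x : V) :
    D.proj j (S.vectorField x) = (D.subsystem j).vectorField (D.proj j x) := by
  conv_lhs => rw [← D.sum_proj x, map_sum]
  simp_rw [vectorField_coe]
  exact D.proj_sum_coe (fun i => (D.subsystem i).vectorField (D.proj i x)) j

theorem aeval_coe (p : ℝ[X]) (j : Fin r) (y : D.comp j) :
    aeval S.vectorField p (y : V) = aeval (D.subsystem j).vectorField p y :=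
  Polynomial.aeval_coe_of_coe (D.vectorField_coe j) p y

theorem aeval_sq_coe (p : ℝ[X]) (j : Fin r) (y : D.comp j) :
    aeval (S.vectorField ^ 2) p (y : V) = aeval ((D.subsystem j).vectorField ^ 2) p y := by
  rw [← aeval_sq_eq, ← aeval_sq_eq, aeval_coe]

theorem aeval_subsystem_pow_eq_zero (j : Fin r) :
    aeval ((D.subsystem j).vectorField ^ 2)
      (sqPoly (D.eigenvalue j) ^ finrank ℝ (D.comp j)) = 0 :=
  (D.subsystem j).aeval_sq_pow_finrank_eq_zero fun w hw => by
    rw [aeval_sqPoly_eq_zero_iff]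
    exact D.eigenvalues_eq j ▸ hw

theorem aeval_prod_eq_zero :
    aeval (S.vectorField ^ 2) (∏ j, sqPoly (D.eigenvalue j) ^ finrank ℝ (D.comp j)) = 0 := by
  ext x
  rw [← D.sum_proj x, map_sum, LinearMap.zero_apply]
  refine Finset.sum_eq_zero fun j _ => ?_
  rw [aeval_sq_coe, ← Finset.prod_erase_mul _ _ (Finset.mem_univ j), map_mul, End.mul_apply,
    aeval_subsystem_pow_eq_zero, LinearMap.zero_apply, map_zero, ZeroMemClass.coe_zero]

theorem eigenvalues_subset : S.eigenvalues ⊆ ⋃ j, quadruplet (D.eigenvalue j) := by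
  intro z hz
  have h := S.aeval_eigenvalue_sq_eq_zero D.aeval_prod_eq_zero hz
  rw [map_prod, Finset.prod_eq_zero_iff] at h
  obtain ⟨j, -, hj⟩ := h
  rw [map_pow] at hj
  exact Set.mem_iUnion.2 ⟨j, aeval_sqPoly_eq_zero_iff.1 (eq_zero_of_pow_eq_zero hj)⟩

theorem moduliNumber_le : S.moduliNumber ≤ ∑ j, quadrupletModuli (D.eigenvalue j) := by
  classical
  have hfin : ∀ j, {w ∈ quadruplet (D.eigenvalue j) |
      0 < w.re ∨ (w.re = 0 ∧ 0 < w.im)}.Finite := fun j => (finite_quadruplet _).sep _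
  have hsub : {z ∈ S.eigenvalues | 0 < z.re ∨ (z.re = 0 ∧ 0 < z.im)} ⊆
      ((Finset.univ.biUnion fun j => (hfin j).toFinset : Finset ℂ) : Set ℂ) := by
    rintro z ⟨hz, hpos⟩
    obtain ⟨j, hj⟩ := Set.mem_iUnion.1 (D.eigenvalues_subset hz)
    simp only [Finset.coe_biUnion, Set.mem_iUnion]
    exact ⟨j, Finset.mem_univ _, (hfin j).mem_toFinset.2 ⟨hj, hpos⟩⟩
  rw [moduliNumber]
  refine (Set.ncard_le_ncard hsub (Finset.finite_toSet _)).trans ?_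
  rw [Set.ncard_coe_finset]
  refine Finset.card_biUnion_le.trans (Finset.sum_le_sum fun j _ => ?_)
  rw [quadrupletModuli, Set.ncard_eq_toFinset_card _ (hfin j)]

/-- Block-diagonal operators assembled from the centralizers of the components commute with `L` and
are skew. -/
theorem sum_finrank_centralizer_le :
    ∑ j, finrank ℝ (D.subsystem j).centralizer ≤ finrank ℝ S.centralizer := by
  let Φ : (∀ j, (D.subsystem j).centralizer) →ₗ[ℝ] End ℝ V :=
    ∑ j, LinearMap.lcomp ℝ V (D.proj j) ∘ₗ LinearMap.compRight ℝ (D.comp j).subtype ∘ₗ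
      (D.subsystem j).centralizer.subtype ∘ₗ LinearMap.proj j
  have hΦ : ∀ B x, Φ B x = ∑ j, ((B j : End ℝ (D.comp j)) (D.proj j x) : V) := by
    intro B x
    simp [Φ, LinearMap.sum_apply]
  have hproj : ∀ B x j, D.proj j (Φ B x) = (B j : End ℝ (D.comp j)) (D.proj j x) := by
    intro B x j
    rw [hΦ]
    exact D.proj_sum_coe (fun i => (B i : End ℝ (D.comp i)) (D.proj i x)) j
  have hmem : ∀ B, Φ B ∈ S.centralizer := by
    intro B
    rw [mem_centralizer]
    refine ⟨fun x y => ?_, fun x => ?_⟩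
    · rw [D.ω_eq_sum, D.ω_eq_sum, ← Finset.sum_neg_distrib]
      refine Finset.sum_congr rfl fun j _ => ?_
      rw [hproj, hproj]
      exact ((D.subsystem j).mem_centralizer.1 (B j).2).1 _ _
    · rw [hΦ, hΦ, map_sum]
      refine Finset.sum_congr rfl fun j _ => ?_
      rw [proj_vectorField, ((D.subsystem j).mem_centralizer.1 (B j).2).2, vectorField_coe]
  have hinj : Function.Injective (Φ.codRestrict S.centralizer hmem) := by
    rw [← LinearMap.ker_eq_bot, LinearMap.ker_eq_bot']
    intro B hB
    have hB' : Φ B = 0 := congrArg Subtype.val hB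
    ext j y
    have := hproj B y j
    rw [hB', LinearMap.zero_apply, map_zero, proj_coe] at this
    rw [← this]
    simp
  have := LinearMap.finrank_le_finrank_of_injective hinj
  rwa [Module.finrank_pi_fintype] at this

theorem quadrupletModuli_le_finrank_centralizer (j : Fin r) :
    quadrupletModuli (D.eigenvalue j) ≤ finrank ℝ (D.subsystem j).centralizer := by
  by_cases h : D.eigenvalue j = 0
  · rw [h, quadrupletModuli_zero]
    exact Nat.zero_le _
  · exact (quadrupletModuli_le _).trans
      ((D.subsystem j).natDegree_sqPoly_le_finrank_centralizer (D.eigenvalues_eq j) h)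

/-- The codimension is at least the sum over the components of centralizer dimension minus moduli.
All terms are nonnegative, so none exceeds 1. -/
theorem finrank_centralizer_le (hcodim : S.codimension ≤ 1) (j : Fin r) :
    finrank ℝ (D.subsystem j).centralizer ≤ quadrupletModuli (D.eigenvalue j) + 1 := by
  rw [codimension_eq] at hcodim
  have h₁ := D.sum_finrank_centralizer_le
  have h₂ := D.moduliNumber_le
  rw [← Finset.add_sum_erase _ _ (Finset.mem_univ j)] at h₁ h₂
  have h₃ := Finset.sum_le_sum (s := Finset.univ.erase j) fun i _ =>
    D.quadrupletModuli_le_finrank_centralizer i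
  omega

/-- A component with eigenvalue 0 has no moduli, so its centralizer, and with it its kernel, has
dimension at most 1. The other components have no kernel, so `ker L` would have dimension exactly 1,
against its evenness. -/
theorem eigenvalue_ne_zero (hsig : S.signature = 0) (hcodim : S.codimension ≤ 1) (j : Fin r) :
    D.eigenvalue j ≠ 0 := by
  intro hj
  have h0 : (0 : ℂ) ∈ (D.subsystem j).eigenvalues := by
    rw [subsystem, D.eigenvalues_eq j, hj]
    exact mem_quadruplet_self 0
  have hle := D.finrank_centralizer_le hcodim j
  rw [hj, quadrupletModuli_zero] at hle
  have hC := (D.subsystem j).finrank_ker_le_finrank_centralizer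
  have hother : ∀ i, i ≠ j → LinearMap.ker (D.subsystem i).vectorField = ⊥ := by
    intro i hi
    apply (D.subsystem i).ker_vectorField_eq_bot
    rw [subsystem, D.eigenvalues_eq i]
    apply zero_notMem_quadruplet
    intro hi0
    apply D.distinct i j hi
    rw [hj, hi0]
  have hker : finrank ℝ (LinearMap.ker S.vectorField) ≤
      finrank ℝ (LinearMap.ker (D.subsystem j).vectorField) := by
    have hmem : ∀ x ∈ LinearMap.ker S.vectorField,
        ∀ i, D.proj i x ∈ LinearMap.ker (D.subsystem i).vectorField := by
      intro x hx i
      rw [LinearMap.mem_ker, ← proj_vectorField, LinearMap.mem_ker.1 hx, map_zero]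
    refine LinearMap.finrank_le_finrank_of_injective
      (f := (D.proj j).restrict fun x hx => hmem x hx j) ?_
    rw [← LinearMap.ker_eq_bot, LinearMap.ker_eq_bot']
    rintro ⟨x, hx⟩ h
    have hj' : D.proj j x = 0 := congrArg Subtype.val h
    apply Subtype.ext
    change x = 0
    rw [← D.sum_proj x]
    refine Finset.sum_eq_zero fun i _ => ?_
    by_cases hij : i = j
    · subst hij
      rw [hj', ZeroMemClass.coe_zero]
    · have := hmem x hx i
      rw [hother i hij, Submodule.mem_bot] at this
      rw [this, ZeroMemClass.coe_zero]
  have hpos : 0 < finrank ℝ (LinearMap.ker S.vectorField) := by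
    obtain ⟨x, hx, hLx⟩ := (D.subsystem j).exists_real_eigenvector (a := 0) (by simpa using h0)
    rw [Nat.pos_iff_ne_zero, Ne, Submodule.finrank_eq_zero, ← Ne, Submodule.ne_bot_iff]
    refine ⟨x, ?_, fun h => hx (Subtype.ext h)⟩
    rw [LinearMap.mem_ker, vectorField_coe, hLx, zero_smul, ZeroMemClass.coe_zero]
  obtain ⟨k, hk⟩ := S.even_finrank_ker_of_signature_eq_zero hsig
  omega

theorem isSimpleBlock (hsig : S.signature = 0) (hcodim : S.codimension ≤ 1) (j : Fin r) :
    (D.subsystem j).IsSimpleBlock (D.eigenvalue j) := by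
  apply isSimpleBlock_of_finrank_centralizer_le
  · exact D.eigenvalues_eq j
  · exact D.eigenvalue_ne_zero hsig hcodim j
  · exact (D.finrank_centralizer_le hcodim j).trans
      (Nat.add_le_add_right (quadrupletModuli_le _) 1)

end Splitting

end LinearHamiltonianSystem

/-! ### Existence of a splitting by primary decomposition of `L²`. -/

theorem Polynomial.ker_aeval_prod_le_iSup {K V ι : Type*} [Field K] [AddCommGroup V] [Module K V]
    (f : End K V) {p : ι → K[X]} (hp : Pairwise fun i j => IsCoprime (p i) (p j))
    (s : Finset ι) :
    LinearMap.ker (aeval f (∏ i ∈ s, p i)) ≤ ⨆ i ∈ s, LinearMap.ker (aeval f (p i)) := by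
  classical
  induction s using Finset.induction with
  | empty =>
    rw [Finset.prod_empty, map_one, End.one_eq_id, LinearMap.ker_id]
    exact bot_le
  | insert a s ha ih =>
    rw [Finset.prod_insert ha, Finset.iSup_insert, ← sup_ker_aeval_eq_ker_aeval_mul_of_coprime]
    · exact sup_le_sup le_rfl ih
    · exact IsCoprime.prod_right fun i hi => hp fun h => ha (h ▸ hi)

theorem Polynomial.isInternal_ker_aeval {K V ι : Type*} [Field K] [AddCommGroup V] [Module K V]
    [Fintype ι] [DecidableEq ι] (f : End K V) {p : ι → K[X]}
    (hp : Pairwise fun i j => IsCoprime (p i) (p j)) (hf : aeval f (∏ i, p i) = 0) :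
    DirectSum.IsInternal fun i => LinearMap.ker (aeval f (p i)) := by
  rw [DirectSum.isInternal_submodule_iff_iSupIndep_and_iSup_eq_top]
  constructor
  · intro i
    have hcop : IsCoprime (p i) (∏ j ∈ Finset.univ.erase i, p j) :=
      IsCoprime.prod_right fun j hj => hp (Finset.ne_of_mem_erase hj).symm
    refine (disjoint_ker_aeval_of_isCoprime f hcop).mono_right ?_
    refine iSup₂_le fun j hj => ?_
    intro x hx
    rw [LinearMap.mem_ker] at hx ⊢
    rw [← Finset.prod_erase_mul _ _ (Finset.mem_erase.2 ⟨hj, Finset.mem_univ j⟩), map_mul,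
      End.mul_apply, hx, map_zero]
  · have h := ker_aeval_prod_le_iSup f hp Finset.univ
    rw [hf, LinearMap.ker_zero] at h
    simpa using h

namespace LinearHamiltonianSystem

variable {V : Type*} [AddCommGroup V] [Module ℝ V] [FiniteDimensional ℝ V]
  (S : LinearHamiltonianSystem V)

theorem restrict_vectorField_coe {W : Submodule ℝ V} (hW : (S.ω.restrict W).Nondegenerate)
    (hinv : ∀ x ∈ W, S.vectorField x ∈ W) (y : W) :
    S.vectorField y = (S.restrict W hW).vectorField y := by
  have h : (⟨S.vectorField y, hinv y y.2⟩ : W) - (S.restrict W hW).vectorField y = 0 := by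
    apply hW.2
    intro x
    have h₁ := S.ω_vectorField x y
    have h₂ := (S.restrict W hW).ω_vectorField x y
    have h₃ := LinearMap.congr_fun₂ (QuadraticMap.associated_comp ℝ S.H W.subtype) x y
    rw [map_sub, sub_eq_zero]
    refine Eq.trans ?_ h₂.symm
    refine Eq.trans ?_ h₃.symm
    exact h₁
  exact congrArg Subtype.val (sub_eq_zero.1 h)

/-- Polynomials in `L²` are self-adjoint for `ω`. By Bézout `y = (ap)(L²) y`, and `(ap)(L²)` moved
to the other side kills `x`. -/
theorem ω_eq_zero_of_isCoprime {p q : ℝ[X]} (hpq : IsCoprime p q) {x y : V}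
    (hx : aeval (S.vectorField ^ 2) p x = 0) (hy : aeval (S.vectorField ^ 2) q y = 0) :
    S.ω x y = 0 := by
  obtain ⟨a, b, hab⟩ := hpq
  have h : y = aeval (S.vectorField ^ 2) (a * p) y := by
    have := LinearMap.congr_fun (congrArg (aeval (S.vectorField ^ 2)) hab) y
    simpa [hy] using this.symm
  rw [h, ← ω_aeval_sq_left, map_mul, End.mul_apply, hx, map_zero, map_zero, LinearMap.zero_apply]

theorem restrict_nondegenerate_of_iSup {U : Type*} [AddCommGroup U] [Module ℝ U]
    (S : LinearHamiltonianSystem U) {ι : Type*} {W : ι → Submodule ℝ U} (hW : iSup W = ⊤)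
    (horth : ∀ i j, i ≠ j → ∀ x ∈ W i, ∀ y ∈ W j, S.ω x y = 0) (i : ι) :
    (S.ω.restrict (W i)).Nondegenerate := by
  have key : ∀ x : W i, (∀ y : W i, S.ω x y = 0) → x = 0 := by
    intro x hx
    ext1
    apply S.nondegenerate.1
    intro v
    have hle : iSup W ≤ LinearMap.ker (S.ω x) := by
      refine iSup_le fun j y hy => ?_
      rw [LinearMap.mem_ker]
      by_cases hij : i = j
      · subst hij
        exact hx ⟨y, hy⟩
      · exact horth i j hij x x.2 y hy
    rw [hW] at hle
    exact hle (Submodule.mem_top : v ∈ ⊤)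
  refine ⟨key, fun x hx => key x fun y => ?_⟩
  rw [← S.isAlt.neg_eq, neg_eq_zero]
  exact hx y

theorem exists_splitting : ∃ r : ℕ, Nonempty (S.Splitting r) := by
  classical
  -- Indexing by the polynomials instead of the eigenvalues gives one component per quadruplet.
  set Q : Finset ℝ[X] := S.finite_eigenvalues.toFinset.image sqPoly
  have hchoose : ∀ j : Fin Q.card, ∃ z ∈ S.eigenvalues, sqPoly z = (Q.equivFin.symm j : ℝ[X]) := by
    intro j
    have := (Q.equivFin.symm j).2
    obtain ⟨z, hz, h⟩ := Finset.mem_image.1 this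
    exact ⟨z, S.finite_eigenvalues.mem_toFinset.1 hz, h⟩
  choose z hz hzQ using hchoose
  have hquad : ∀ i j, i ≠ j → quadruplet (z i) ≠ quadruplet (z j) := by
    intro i j hij h
    apply hij
    apply Q.equivFin.symm.injective
    apply Subtype.ext
    rw [← hzQ, ← hzQ]
    apply sqPoly_eq_of_mem_quadruplet
    rw [← h]
    exact mem_quadruplet_self _
  set n := finrank ℝ V with hn
  have hcop : Pairwise fun i j => IsCoprime (sqPoly (z i) ^ n) (sqPoly (z j) ^ n) :=
    fun i j hij => (isCoprime_sqPoly (hquad i j hij)).pow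
  have hzero : aeval (S.vectorField ^ 2) (∏ j, sqPoly (z j) ^ n) = 0 := by
    rw [Finset.prod_pow]
    apply S.aeval_sq_pow_finrank_eq_zero
    intro w hw
    have hwQ : sqPoly w ∈ Q := Finset.mem_image_of_mem _ (S.finite_eigenvalues.mem_toFinset.2 hw)
    rw [map_prod]
    apply Finset.prod_eq_zero (Finset.mem_univ (Q.equivFin ⟨_, hwQ⟩))
    rw [hzQ, Equiv.symm_apply_apply]
    exact aeval_sqPoly_self w
  set W : Fin Q.card → Submodule ℝ V := fun j =>
    LinearMap.ker (aeval (S.vectorField ^ 2) (sqPoly (z j) ^ n)) with hW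
  have hint : DirectSum.IsInternal W := isInternal_ker_aeval _ hcop hzero
  have horth : ∀ i j, i ≠ j → ∀ x ∈ W i, ∀ y ∈ W j, S.ω x y = 0 := fun i j hij x hx y hy =>
    S.ω_eq_zero_of_isCoprime (hcop hij) hx hy
  have hinv : ∀ j, ∀ x ∈ W j, S.vectorField x ∈ W j := by
    intro j x hx
    rw [hW, LinearMap.mem_ker, aeval_sq_commute, LinearMap.mem_ker.1 hx, map_zero]
  have hsymp := S.restrict_nondegenerate_of_iSup hint.submodule_iSup_eq_top horth
  refine ⟨Q.card, ⟨⟨W, hint, hsymp, horth, ?_, z, ?_, hquad⟩⟩⟩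
  · intro i j hij x hx y hy
    have h : QuadraticMap.associated (R := ℝ) S.H x y = 0 := by
      rw [← ω_vectorField]
      exact horth i j hij x hx _ (hinv j y hy)
    exact QuadraticMap.associated_isOrtho.1 h
  · intro j
    have hsub : (S.restrict (W j) (hsymp j)).eigenvalues ⊆ quadruplet (z j) := by
      intro w hw
      have h0 : aeval ((S.restrict (W j) (hsymp j)).vectorField ^ 2) (sqPoly (z j) ^ n) = 0 := by
        ext y
        have h := Polynomial.aeval_coe_of_coe (S.restrict_vectorField_coe (hsymp j) (hinv j))
          ((sqPoly (z j) ^ n).comp (X ^ 2)) y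
        rw [aeval_sq_eq, aeval_sq_eq] at h
        rw [← h]
        exact y.2
      have h := aeval_eigenvalue_sq_eq_zero _ h0 hw
      rw [map_pow] at h
      exact aeval_sqPoly_eq_zero_iff.1 (eq_zero_of_pow_eq_zero h)
    refine hsub.antisymm ?_
    -- A nonzero component has some eigenvalue `w`; its spectrum then contains the quadruplet of
    -- `w`, which is that of `z j`.
    have hne : W j ≠ ⊥ := by
      apply S.ker_aeval_sq_ne_bot (hz j)
      rw [map_pow, aeval_sqPoly_self]
      exact zero_pow (S.finrank_pos_of_mem_eigenvalues (hz j)).ne'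
    have : Nontrivial (W j) := (Submodule.nontrivial_iff_ne_bot).2 hne
    obtain ⟨w, hw⟩ := (S.restrict (W j) (hsymp j)).exists_mem_eigenvalues
    rw [← quadruplet_eq_of_sqPoly_eq (sqPoly_eq_of_mem_quadruplet (hsub hw))]
    exact quadruplet_subset_eigenvalues _ hw

end LinearHamiltonianSystem

/-! ### Null Lagrangians as invariant Lagrangians, and their product decomposition. -/

theorem Polynomial.aeval_apply_mem_of_invariant {K V : Type*} [Field K] [AddCommGroup V]
    [Module K V] {f : End K V} {W : Submodule K V} (h : ∀ x ∈ W, f x ∈ W) (p : K[X]) {x : V}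
    (hx : x ∈ W) : aeval f p x ∈ W := by
  have h₁ := aeval_coe_of_coe (f := f) (g := f.restrict h) (fun _ => rfl) p ⟨x, hx⟩
  rw [h₁]
  exact Subtype.coe_prop _

namespace LinearHamiltonianSystem

variable {V : Type*} [AddCommGroup V] [Module ℝ V] [FiniteDimensional ℝ V]

/-- The Lagrangian subspaces contained in the null-cone. -/
def nullLagrangians (S : LinearHamiltonianSystem V) : Set (Submodule ℝ V) :=
  {W | S.IsLagrangian W ∧ (W : Set V) ⊆ S.nullCone}

theorem H_eq_ω (S : LinearHamiltonianSystem V) (x : V) : S.H x = S.ω x (S.vectorField x) := by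
  rw [ω_vectorField, QuadraticMap.associated_eq_self_apply]

/-- `H` vanishes on `W` exactly when its bilinear form `ω(·, L ·)` does, that is when `L W` lies in
the orthogonal of `W`, which is `W`. -/
theorem mem_nullLagrangians_iff (S : LinearHamiltonianSystem V) {W : Submodule ℝ V} :
    W ∈ S.nullLagrangians ↔ S.IsLagrangian W ∧ ∀ x ∈ W, S.vectorField x ∈ W := by
  refine and_congr_right fun hL => ⟨fun h x hx => ?_, fun h x hx => ?_⟩
  · rw [IsLagrangian] at hL
    rw [← hL, LinearMap.BilinForm.mem_orthogonal_iff]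
    intro y hy
    rw [ω_vectorField]
    have h₁ : S.H (y + x) = 0 := h (W.add_mem hy hx)
    have h₂ : S.H y = 0 := h hy
    have h₃ : S.H x = 0 := h hx
    refine QuadraticMap.associated_isOrtho.2 ?_
    rw [QuadraticMap.isOrtho_def, h₁, h₂, h₃, add_zero]
  · change S.H x = 0
    rw [H_eq_ω]
    exact (S.isLagrangian_iff.1 hL).1 x hx _ (h x hx)

namespace Splitting

variable {S : LinearHamiltonianSystem V} {r : ℕ} (D : S.Splitting r)

/-- Bézout applied to the annihilator of component `j` and the product of the others gives a
polynomial acting as 1 on that component and as 0 elsewhere. Hence invariant subspaces are stable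
under the projections. -/
theorem exists_aeval_eq_proj (j : Fin r) :
    ∃ p : ℝ[X], ∀ x, aeval (S.vectorField ^ 2) p x = (D.proj j x : V) := by
  set P : Fin r → ℝ[X] := fun i => sqPoly (D.eigenvalue i) ^ finrank ℝ (D.comp i) with hP
  have hcop : IsCoprime (∏ i ∈ Finset.univ.erase j, P i) (P j) :=
    IsCoprime.prod_left fun i hi =>
      (isCoprime_sqPoly (D.distinct i j (Finset.ne_of_mem_erase hi))).pow
  obtain ⟨a, b, hab⟩ := hcop
  have hzero : ∀ i (y : D.comp i), aeval (S.vectorField ^ 2) (P i) (y : V) = 0 := by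
    intro i y
    rw [aeval_sq_coe, aeval_subsystem_pow_eq_zero, LinearMap.zero_apply, ZeroMemClass.coe_zero]
  refine ⟨a * ∏ i ∈ Finset.univ.erase j, P i, fun x => ?_⟩
  conv_lhs => rw [← D.sum_proj x, map_sum]
  rw [Finset.sum_eq_single j]
  · have h := LinearMap.congr_fun (congrArg (aeval (S.vectorField ^ 2)) hab) (D.proj j x : V)
    rw [map_add, map_mul _ b, LinearMap.add_apply, End.mul_apply, hzero, map_zero, add_zero,
      map_one, End.one_apply] at h
    exact h
  · intro i _ hi
    rw [← Finset.prod_erase_mul _ _ (Finset.mem_erase.2 ⟨hi, Finset.mem_univ i⟩), ← mul_assoc,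
      map_mul, End.mul_apply, hzero, map_zero]
  · simp

theorem proj_mem_of_invariant {W : Submodule ℝ V} (hW : ∀ x ∈ W, S.vectorField x ∈ W) {x : V}
    (hx : x ∈ W) (j : Fin r) : (D.proj j x : V) ∈ W := by
  obtain ⟨p, hp⟩ := D.exists_aeval_eq_proj j
  rw [← hp]
  refine Polynomial.aeval_apply_mem_of_invariant (fun y hy => ?_) p hx
  rw [pow_two, End.mul_apply]
  exact hW _ (hW _ hy)

theorem comap_mem_nullLagrangians {W : Submodule ℝ V} (hW : W ∈ S.nullLagrangians) (j : Fin r) :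
    W.comap (D.comp j).subtype ∈ (D.subsystem j).nullLagrangians := by
  rw [mem_nullLagrangians_iff] at hW ⊢
  obtain ⟨hL, hinv⟩ := hW
  constructor
  · rw [IsLagrangian] at hL ⊢
    ext y
    rw [LinearMap.BilinForm.mem_orthogonal_iff, Submodule.mem_comap, Submodule.subtype_apply, ← hL,
      LinearMap.BilinForm.mem_orthogonal_iff, hL]
    constructor
    · intro h x hx
      rw [D.ω_coe_right]
      exact h _ (D.proj_mem_of_invariant hinv hx j)
    · intro h x hx
      have := h x hx
      rwa [D.ω_coe_right, proj_coe] at this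
  · intro y hy
    rw [Submodule.mem_comap, Submodule.subtype_apply, ← vectorField_coe]
    exact hinv _ hy

theorem iInf_mem_nullLagrangians {W : ∀ j, Submodule ℝ (D.comp j)}
    (hW : ∀ j, W j ∈ (D.subsystem j).nullLagrangians) :
    (⨅ j, (W j).comap (D.proj j)) ∈ S.nullLagrangians := by
  simp only [mem_nullLagrangians_iff] at hW ⊢
  constructor
  · rw [IsLagrangian]
    ext x
    simp only [LinearMap.BilinForm.mem_orthogonal_iff, Submodule.mem_iInf, Submodule.mem_comap]
    constructor
    · intro h j
      have hL := (hW j).1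
      rw [IsLagrangian] at hL
      rw [← hL, LinearMap.BilinForm.mem_orthogonal_iff]
      intro n hn
      have hx := h n fun i => by
        by_cases hij : i = j
        · subst hij
          rwa [proj_coe]
        · rw [D.proj_coe_of_ne hij]
          exact Submodule.zero_mem _
      rw [← S.isAlt.neg_eq, neg_eq_zero, D.ω_coe_right] at hx
      rw [← (D.subsystem j).isAlt.neg_eq, hx, neg_zero]
    · intro h n hn
      rw [D.ω_eq_sum]
      exact Finset.sum_eq_zero fun j _ =>
        ((D.subsystem j).isLagrangian_iff.1 (hW j).1).1 _ (hn j) _ (h j)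
  · intro x hx
    simp only [Submodule.mem_iInf, Submodule.mem_comap] at hx ⊢
    intro j
    rw [proj_vectorField]
    exact (hW j).2 _ (hx j)

/-- The Lagrangian subspaces in the null-cone of a split system are the direct sums of those of
the components. -/
def nullLagrangiansEquiv :
    S.nullLagrangians ≃ ∀ j, (D.subsystem j).nullLagrangians where
  toFun W j := ⟨_, D.comap_mem_nullLagrangians W.2 j⟩
  invFun W := ⟨_, D.iInf_mem_nullLagrangians fun j => (W j).2⟩
  left_inv W := by
    ext x
    simp only [Submodule.mem_iInf, Submodule.mem_comap, Submodule.subtype_apply]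
    constructor
    · intro h
      rw [← D.sum_proj x]
      exact Submodule.sum_mem _ fun j _ => h j
    · intro h
      exact D.proj_mem_of_invariant ((mem_nullLagrangians_iff S).1 W.2).2 h
  right_inv W := by
    ext j y
    simp only [Submodule.mem_iInf, Submodule.mem_comap, Submodule.subtype_apply]
    constructor
    · intro h
      have := h j
      rwa [proj_coe] at this
    · intro h i
      by_cases hij : i = j
      · subst hij
        rwa [proj_coe]
      · rw [D.proj_coe_of_ne hij]
        exact Submodule.zero_mem _

theorem encard_nullLagrangians {n : Fin r → ℕ}
    (h : ∀ j, (D.subsystem j).nullLagrangians.encard = n j) :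
    S.nullLagrangians.encard = ((∏ j, n j : ℕ) : ℕ∞) := by
  have hfin : ∀ j, Finite (D.subsystem j).nullLagrangians := fun j =>
    Set.finite_of_encard_eq_coe (h j)
  have : Finite S.nullLagrangians := Finite.of_equiv _ D.nullLagrangiansEquiv.symm
  have hcard : ∀ j, Nat.card (D.subsystem j).nullLagrangians = n j := by
    intro j
    rw [Nat.card_coe_set_eq, Set.ncard, h j, ENat.toNat_natCast]
  rw [← (Set.toFinite S.nullLagrangians).cast_ncard_eq, ← Nat.card_coe_set_eq,
    Nat.card_congr D.nullLagrangiansEquiv, Nat.card_pi]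
  simp_rw [hcard]

end Splitting

end LinearHamiltonianSystem

/-! ### Counting invariant Lagrangians in a single block. -/

namespace LinearHamiltonianSystem

variable {V : Type*} [AddCommGroup V] [Module ℝ V] [FiniteDimensional ℝ V]
  (S : LinearHamiltonianSystem V)

theorem two_mul_finrank_le_of_isotropic {W : Submodule ℝ V}
    (h : ∀ x ∈ W, ∀ y ∈ W, S.ω x y = 0) : 2 * finrank ℝ W ≤ finrank ℝ V := by
  have hfin := LinearMap.BilinForm.finrank_orthogonal S.nondegenerate W
  have hle : W ≤ S.ω.orthogonal W := fun y hy =>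
    LinearMap.BilinForm.mem_orthogonal_iff.2 fun x hx => h x hx y hy
  have h₁ := Submodule.finrank_mono hle
  have h₂ := Submodule.finrank_le W
  omega

theorem aeval_vectorField_commute (p : ℝ[X]) (x : V) :
    aeval S.vectorField p (S.vectorField x) = S.vectorField (aeval S.vectorField p x) := by
  have h := congrArg (fun q => aeval S.vectorField q x) (mul_comm p X)
  simpa only [map_mul, aeval_X, End.mul_apply] using h

theorem vectorField_mem_ker_aeval (p : ℝ[X]) {x : V}
    (hx : x ∈ LinearMap.ker (aeval S.vectorField p)) :
    S.vectorField x ∈ LinearMap.ker (aeval S.vectorField p) := by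
  rw [LinearMap.mem_ker] at hx ⊢
  rw [aeval_vectorField_commute, hx, map_zero]

/-- The adjoint of `p(L)` is `p(-L) = q(L)`, and `q(L)` is invertible on `ker p(L)` by coprimality;
writing `y = q(L) y'` moves `p(L)` onto `x`. -/
theorem isotropic_ker_aeval {p q : ℝ[X]} (hpq : IsCoprime p q) (hq : p.comp (-X) = q) {x y : V}
    (hx : aeval S.vectorField p x = 0) (hy : aeval S.vectorField p y = 0) : S.ω x y = 0 := by
  obtain ⟨a, b, hab⟩ := hpq
  have h : aeval S.vectorField q (aeval S.vectorField b y) = y := by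
    have := LinearMap.congr_fun (congrArg (aeval S.vectorField) hab) y
    rw [mul_comm b q] at this
    simpa [hy] using this
  rw [← h, ← hq, aeval_comp, map_neg, aeval_X, ← ω_aeval_left, hx, map_zero, LinearMap.zero_apply]

/-- Both kernels are isotropic, hence of at most half dimension, and together they span `V`. -/
theorem isLagrangian_ker_aeval {p q : ℝ[X]} (hpq : IsCoprime p q) (hq : p.comp (-X) = q)
    (h0 : aeval S.vectorField (p * q) = 0) :
    S.IsLagrangian (LinearMap.ker (aeval S.vectorField p)) ∧
      S.IsLagrangian (LinearMap.ker (aeval S.vectorField q)) := by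
  have hp : q.comp (-X) = p := by rw [← hq, comp_assoc]; simp
  have hA : ∀ x ∈ LinearMap.ker (aeval S.vectorField p),
      ∀ y ∈ LinearMap.ker (aeval S.vectorField p), S.ω x y = 0 := fun x hx y hy =>
    S.isotropic_ker_aeval hpq hq hx hy
  have hB : ∀ x ∈ LinearMap.ker (aeval S.vectorField q),
      ∀ y ∈ LinearMap.ker (aeval S.vectorField q), S.ω x y = 0 := fun x hx y hy =>
    S.isotropic_ker_aeval hpq.symm hp hx hy
  have hsup := sup_ker_aeval_eq_ker_aeval_mul_of_coprime S.vectorField hpq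
  rw [h0, LinearMap.ker_zero] at hsup
  have hdim := Submodule.finrank_add_le_finrank_add_finrank
    (LinearMap.ker (aeval S.vectorField p)) (LinearMap.ker (aeval S.vectorField q))
  rw [hsup, finrank_top] at hdim
  have h₁ := S.two_mul_finrank_le_of_isotropic hA
  have h₂ := S.two_mul_finrank_le_of_isotropic hB
  rw [isLagrangian_iff, isLagrangian_iff]
  exact ⟨⟨hA, by omega⟩, ⟨hB, by omega⟩⟩

theorem eq_sup_of_invariant {p q : ℝ[X]} (hpq : IsCoprime p q)
    (h0 : aeval S.vectorField (p * q) = 0) {W : Submodule ℝ V}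
    (hW : ∀ x ∈ W, S.vectorField x ∈ W) :
    W = W ⊓ LinearMap.ker (aeval S.vectorField p) ⊔ W ⊓ LinearMap.ker (aeval S.vectorField q) := by
  refine le_antisymm (fun x hx => ?_) (sup_le inf_le_left inf_le_left)
  obtain ⟨a, b, hab⟩ := hpq
  have h := LinearMap.congr_fun (congrArg (aeval S.vectorField) hab) x
  rw [map_add, LinearMap.add_apply, map_one, End.one_apply, add_comm] at h
  rw [← h]
  refine Submodule.add_mem_sup ⟨Polynomial.aeval_apply_mem_of_invariant hW _ hx, ?_⟩
    ⟨Polynomial.aeval_apply_mem_of_invariant hW _ hx, ?_⟩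
  · rw [SetLike.mem_coe, LinearMap.mem_ker, ← End.mul_apply, ← map_mul,
      show p * (b * q) = b * (p * q) by ring, map_mul, h0, mul_zero, LinearMap.zero_apply]
  · rw [SetLike.mem_coe, LinearMap.mem_ker, ← End.mul_apply, ← map_mul,
      show q * (a * p) = a * (p * q) by ring, map_mul, h0, mul_zero, LinearMap.zero_apply]

theorem exists_eigenvector_of_finrank_eq_one {W : Submodule ℝ V} (h : finrank ℝ W = 1)
    (hW : ∀ x ∈ W, S.vectorField x ∈ W) : ∃ a : ℝ, (∀ x ∈ W, S.vectorField x = a • x) ∧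
      (a : ℂ) ∈ S.eigenvalues := by
  obtain ⟨v, hv0, hv⟩ := finrank_eq_one_iff'.1 h
  obtain ⟨a, ha⟩ := hv ⟨S.vectorField v, hW v v.2⟩
  have ha' : S.vectorField v = a • (v : V) := (congrArg Subtype.val ha).symm
  refine ⟨a, fun x hx => ?_, S.ofReal_mem_eigenvalues ha' fun h => hv0 (Subtype.ext h)⟩
  obtain ⟨c, hc⟩ := hv ⟨x, hx⟩
  have hc' : c • (v : V) = x := congrArg Subtype.val hc
  rw [← hc', map_smul, ha', smul_comm]

/-- An invariant Lagrangian subspace either is one of two complementary invariant Lagrangian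
subspaces, or meets both of them. -/
theorem eq_or_eq_or_finrank_pos {p q : ℝ[X]} (hpq : IsCoprime p q) (hq : p.comp (-X) = q)
    (h0 : aeval S.vectorField (p * q) = 0) {W : Submodule ℝ V} (hW : W ∈ S.nullLagrangians) :
    W = LinearMap.ker (aeval S.vectorField p) ∨ W = LinearMap.ker (aeval S.vectorField q) ∨
    (0 < finrank ℝ (W ⊓ LinearMap.ker (aeval S.vectorField p) : Submodule ℝ V) ∧
      0 < finrank ℝ (W ⊓ LinearMap.ker (aeval S.vectorField q) : Submodule ℝ V) ∧
      2 * (finrank ℝ (W ⊓ LinearMap.ker (aeval S.vectorField p) : Submodule ℝ V) +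
        finrank ℝ (W ⊓ LinearMap.ker (aeval S.vectorField q) : Submodule ℝ V)) =
          finrank ℝ V) := by
  rw [mem_nullLagrangians_iff] at hW
  have hsup := S.eq_sup_of_invariant hpq h0 hW.2
  obtain ⟨hA, hB⟩ := S.isLagrangian_ker_aeval hpq hq h0
  have hdis := disjoint_ker_aeval_of_isCoprime S.vectorField hpq
  set A := LinearMap.ker (aeval S.vectorField p)
  set B := LinearMap.ker (aeval S.vectorField q)
  have hA' := (S.isLagrangian_iff.1 hA).2
  have hB' := (S.isLagrangian_iff.1 hB).2
  have hW' := (S.isLagrangian_iff.1 hW.1).2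
  have hsum := Submodule.finrank_sup_add_finrank_inf_eq (W ⊓ A) (W ⊓ B)
  have hbot : W ⊓ A ⊓ (W ⊓ B) = ⊥ :=
    (hdis.mono inf_le_right inf_le_right).eq_bot
  rw [← hsup, hbot, finrank_bot] at hsum
  by_cases h₁ : W ⊓ A = ⊥
  · right; left
    rw [h₁, bot_sup_eq] at hsup
    refine Submodule.eq_of_le_of_finrank_eq ?_ (by omega)
    rw [hsup]
    exact inf_le_right
  · by_cases h₂ : W ⊓ B = ⊥
    · left
      rw [h₂, sup_bot_eq] at hsup
      refine Submodule.eq_of_le_of_finrank_eq ?_ (by omega)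
      rw [hsup]
      exact inf_le_right
    · right; right
      rw [← Submodule.finrank_eq_zero] at h₁ h₂
      omega

theorem ker_aeval_mem_nullLagrangians {p q : ℝ[X]} (hpq : IsCoprime p q) (hq : p.comp (-X) = q)
    (h0 : aeval S.vectorField (p * q) = 0) :
    LinearMap.ker (aeval S.vectorField p) ∈ S.nullLagrangians ∧
      LinearMap.ker (aeval S.vectorField q) ∈ S.nullLagrangians := by
  simp only [mem_nullLagrangians_iff]
  obtain ⟨hA, hB⟩ := S.isLagrangian_ker_aeval hpq hq h0
  exact ⟨⟨hA, fun x => S.vectorField_mem_ker_aeval p⟩, ⟨hB, fun x => S.vectorField_mem_ker_aeval q⟩⟩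

theorem ker_aeval_ne [Nontrivial V] {p q : ℝ[X]} (hpq : IsCoprime p q) (hq : p.comp (-X) = q)
    (h0 : aeval S.vectorField (p * q) = 0) :
    LinearMap.ker (aeval S.vectorField p) ≠ LinearMap.ker (aeval S.vectorField q) := by
  intro h
  have hdis := disjoint_ker_aeval_of_isCoprime S.vectorField hpq
  have hA := (S.isLagrangian_iff.1 (S.isLagrangian_ker_aeval hpq hq h0).1).2
  rw [← h, disjoint_self] at hdis
  rw [hdis, finrank_bot] at hA
  have := Module.finrank_pos (R := ℝ) (M := V)
  omega

theorem im_eq_zero_of_ofReal_mem_quadruplet {z : ℂ} {a : ℝ}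
    (ha : (a : ℂ) ∈ quadruplet z) : z.im = 0 := by
  simp only [quadruplet, Set.mem_insert_iff, Set.mem_singleton_iff, Complex.ext_iff,
    Complex.ofReal_re, Complex.ofReal_im, Complex.neg_re, Complex.neg_im, Complex.conj_re,
    Complex.conj_im] at ha
  rcases ha with h | h | h | h <;> linarith [h.2]

namespace IsSimpleBlock

variable {S} {z : ℂ}

theorem nontrivial (h : S.IsSimpleBlock z) : Nontrivial V := by
  apply Module.nontrivial_of_finrank_pos (R := ℝ)
  rcases h.finrank_eq with h | h <;> omega

/-- An invariant line is spanned by an eigenvector with real eigenvalue, which a non-real quadruplet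
does not contain. -/
theorem finrank_ne_one_of_im_ne_zero (h : S.IsSimpleBlock z) (hz : z.im ≠ 0) {W : Submodule ℝ V}
    (hW : ∀ x ∈ W, S.vectorField x ∈ W) : finrank ℝ W ≠ 1 := by
  intro h1
  obtain ⟨a, -, ha⟩ := S.exists_eigenvector_of_finrank_eq_one h1 hW
  rw [h.eigenvalues_eq] at ha
  exact hz (im_eq_zero_of_ofReal_mem_quadruplet ha)

theorem im_ne_zero_of_re_eq_zero (h : S.IsSimpleBlock z) (hz : z.re = 0) : z.im ≠ 0 := fun hi =>
  h.ne_zero (Complex.ext (by simpa using hz) (by simpa using hi))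

theorem encard_of_finrank_two_of_re_eq_zero (h : S.IsSimpleBlock z) (h2 : finrank ℝ V = 2)
    (hz : z.re = 0) : S.nullLagrangians.encard = 0 := by
  rw [Set.encard_eq_zero, Set.eq_empty_iff_forall_notMem]
  intro W hW
  rw [mem_nullLagrangians_iff] at hW
  have h1 := (S.isLagrangian_iff.1 hW.1).2
  exact h.finrank_ne_one_of_im_ne_zero (h.im_ne_zero_of_re_eq_zero hz) hW.2 (by omega)

theorem aeval_sub_aeval_sub (h : S.IsSimpleBlock z) {c : ℝ} (hc : z ^ 2 = c) (x : V) :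
    aeval (S.vectorField ^ 2) (X - C c) (aeval (S.vectorField ^ 2) (X - C c) x) = 0 := by
  have hT := h.aeval_sq
  rw [sqPoly_eq_of_real hc, pow_two (X - C c), map_mul] at hT
  exact LinearMap.congr_fun hT x

/-- For a block of dimension four with real or imaginary eigenvalues, the sum of the eigenspaces
is an invariant Lagrangian subspace. -/
theorem ker_sq_sub_mem_nullLagrangians (h : S.IsSimpleBlock z) (h4 : finrank ℝ V = 4) {c : ℝ}
    (hc : z ^ 2 = c) :
    LinearMap.ker (aeval (S.vectorField ^ 2) (X - C c)) ∈ S.nullLagrangians := by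
  set N := aeval (S.vectorField ^ 2) (X - C c) with hN
  have hNN : ∀ x, N (N x) = 0 := h.aeval_sub_aeval_sub hc
  have hrk : LinearMap.range N ≤ LinearMap.ker N := by
    rintro _ ⟨x, rfl⟩
    exact hNN x
  have hE : finrank ℝ (LinearMap.ker N) ≤ 2 := by
    have := S.finrank_ker_aeval_sq_le h.finrank_eigenspace_le (X_sub_C_ne_zero c)
    rwa [natDegree_X_sub_C, mul_one] at this
  have hsum := LinearMap.finrank_range_add_finrank_ker N
  have hmono := Submodule.finrank_mono hrk
  -- The range lies in the kernel, the kernel has dimension at most 2, and the two dimensions add up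
  -- to 4. Isotropy follows, `N` being self-adjoint for `ω`.
  have hEq : LinearMap.range N = LinearMap.ker N :=
    Submodule.eq_of_le_of_finrank_eq hrk (by omega)
  rw [mem_nullLagrangians_iff, isLagrangian_iff]
  refine ⟨⟨fun x hx y hy => ?_, by omega⟩, fun x hx => ?_⟩
  · rw [← hEq] at hx
    obtain ⟨x, rfl⟩ := hx
    rw [hN, ω_aeval_sq_left, ← hN, LinearMap.mem_ker.1 hy, map_zero]
  · rw [LinearMap.mem_ker] at hx ⊢
    rw [hN, aeval_sq_commute, ← hN, hx, map_zero]

/-- With `N = L² - c`, `N² = 0`, an invariant Lagrangian `W` meets `ker N` nontrivially. The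
intersection is invariant and cannot be a line, so it is the whole plane `W`. -/
theorem encard_of_finrank_four_of_re_eq_zero (h : S.IsSimpleBlock z) (h4 : finrank ℝ V = 4)
    (hz : z.re = 0) : S.nullLagrangians.encard = 1 := by
  obtain ⟨c, hc⟩ := exists_sq_eq_ofReal (Or.inl hz)
  have hE := h.ker_sq_sub_mem_nullLagrangians h4 hc
  rw [Set.encard_eq_one]
  refine ⟨_, Set.eq_singleton_iff_unique_mem.2 ⟨hE, fun W hW => ?_⟩⟩
  set N := aeval (S.vectorField ^ 2) (X - C c) with hN
  rw [mem_nullLagrangians_iff] at hE hW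
  have hWd := (S.isLagrangian_iff.1 hW.1).2
  have hEd := (S.isLagrangian_iff.1 hE.1).2
  have hNN : ∀ x, N (N x) = 0 := h.aeval_sub_aeval_sub hc
  have hWN : ∀ x ∈ W, N x ∈ W := fun x hx => by
    refine Polynomial.aeval_apply_mem_of_invariant (fun y hy => ?_) _ hx
    rw [pow_two, End.mul_apply]
    exact hW.2 _ (hW.2 _ hy)
  have hpos : W ⊓ LinearMap.ker N ≠ ⊥ := by
    have hWne : W ≠ ⊥ := by
      rintro rfl
      rw [finrank_bot] at hWd
      omega
    obtain ⟨x, hx, hx0⟩ := Submodule.exists_mem_ne_zero_of_ne_bot hWne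
    rw [Submodule.ne_bot_iff]
    by_cases hNx : N x = 0
    · exact ⟨x, ⟨hx, hNx⟩, hx0⟩
    · exact ⟨N x, ⟨hWN x hx, hNN x⟩, hNx⟩
  have hne1 : finrank ℝ (W ⊓ LinearMap.ker N : Submodule ℝ V) ≠ 1 :=
    h.finrank_ne_one_of_im_ne_zero (h.im_ne_zero_of_re_eq_zero hz) fun x hx =>
      ⟨hW.2 x hx.1, hE.2 x hx.2⟩
  rw [Ne, ← Submodule.finrank_eq_zero] at hpos
  have hle : finrank ℝ (W ⊓ LinearMap.ker N : Submodule ℝ V) ≤ finrank ℝ W :=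
    Submodule.finrank_mono inf_le_left
  have hW' : W ⊓ LinearMap.ker N = W := Submodule.eq_of_le_of_finrank_eq inf_le_left (by omega)
  exact Submodule.eq_of_le_of_finrank_eq (inf_eq_left.1 hW') (by omega)

/-- The kernels of the real quadratic factors with roots `z, z̄` and `-z, -z̄` are invariant
Lagrangians; a third one would meet each of them in an invariant line. -/
theorem encard_of_generic (h : S.IsSimpleBlock z) (hre : z.re ≠ 0) (him : z.im ≠ 0) :
    S.nullLagrangians.encard = 2 := by
  have := h.nontrivial
  have h4 : finrank ℝ V = 4 := by
    refine h.finrank_eq.resolve_left fun h2 => ?_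
    rcases h.of_finrank_two h2 with h | h
    · exact hre h
    · exact him h
  set a := z.re
  set n := Complex.normSq z with hn
  have hn0 : n ≠ 0 := by rw [hn, Ne, Complex.normSq_eq_zero]; exact h.ne_zero
  set p : ℝ[X] := X ^ 2 - C (2 * a) * X + C n with hp
  set q : ℝ[X] := X ^ 2 + C (2 * a) * X + C n with hq
  have hpq : p.comp (-X) = q := by
    simp [hp, hq]
  have hcop : IsCoprime p q := by
    -- From `q - p = 4aX` and `n = p - X (X - 2a)`: eliminate the first factor `X` and divide by
    -- `n`.
    refine ⟨C n⁻¹ * (1 + C (4 * a)⁻¹ * (X - C (2 * a))), -C n⁻¹ * C (4 * a)⁻¹ * (X - C (2 * a)), ?_⟩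
    have h₁ : (C n⁻¹ * C n : ℝ[X]) = 1 := by rw [← C_mul, inv_mul_cancel₀ hn0, C_1]
    have h₂ : (C (4 * a)⁻¹ * C (4 * a) : ℝ[X]) = 1 := by
      rw [← C_mul, inv_mul_cancel₀ (mul_ne_zero four_ne_zero hre), C_1]
    have h₃ : (C (4 * a) : ℝ[X]) = 2 * C (2 * a) := by
      rw [← C_ofNat, ← C_mul]
      congr 1
      ring
    rw [h₃] at h₂
    rw [hp, hq]
    linear_combination h₁ - C n⁻¹ * X * (X - C (2 * a)) * h₂
  have hzero : aeval S.vectorField (p * q) = 0 := by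
    have hdvd := sqPoly_dvd_quadratic z
    rw [map_pow, ← hn] at hdvd
    have hT : aeval (S.vectorField ^ 2) (X ^ 2 - C (2 * (z ^ 2).re) * X + C (n ^ 2)) = 0 := by
      obtain ⟨g, hg⟩ := hdvd
      rw [hg, map_mul, h.aeval_generic hre him, zero_mul]
    rw [← aeval_sq_eq] at hT
    rw [← hT]
    congr 1
    -- This is the coefficient comparison showing that `p q` is the quadratic with roots `z², z̄²`
    -- evaluated at `X²`.
    have h₄ : 2 * (z ^ 2).re = 4 * a ^ 2 - 2 * n := by
      rw [hn, Complex.normSq_apply, pow_two, Complex.mul_re]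
      ring
    rw [hp, hq, h₄]
    simp only [add_comp, sub_comp, mul_comp, X_comp, C_comp, pow_comp, C_sub, C_mul, C_pow,
      C_ofNat, ofNat_comp]
    ring
  obtain ⟨hA, hB⟩ := S.ker_aeval_mem_nullLagrangians hcop hpq hzero
  rw [Set.encard_eq_two]
  refine ⟨_, _, S.ker_aeval_ne hcop hpq hzero, Set.Subset.antisymm (fun W hW => ?_) ?_⟩
  · rcases S.eq_or_eq_or_finrank_pos hcop hpq hzero hW with hWA | hWB | ⟨h₁, h₂, h₃⟩
    · exact Or.inl hWA
    · exact Or.inr hWB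
    · exfalso
      have hinv := ((S.mem_nullLagrangians_iff).1 hW).2
      refine h.finrank_ne_one_of_im_ne_zero him
        (W := W ⊓ LinearMap.ker (aeval S.vectorField p))
        (fun x hx => ⟨hinv x hx.1, S.vectorField_mem_ker_aeval p hx.2⟩) ?_
      omega
  · rintro W (rfl | rfl)
    · exact hA
    · exact hB

/-- The squared factors serve dimensions 2 and 4 alike, since `(L² - z²)² = 0` in both. -/
theorem real_factorization (h : S.IsSimpleBlock z) (hz : z.im = 0) :
    IsCoprime ((X - C z.re : ℝ[X]) ^ 2) ((X + C z.re) ^ 2) ∧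
      ((X - C z.re : ℝ[X]) ^ 2).comp (-X) = (X + C z.re) ^ 2 ∧
      aeval S.vectorField ((X - C z.re : ℝ[X]) ^ 2 * (X + C z.re) ^ 2) = 0 := by
  have hre : z.re ≠ 0 := fun hr => h.ne_zero (Complex.ext (by simpa using hr) (by simpa using hz))
  refine ⟨?_, ?_, ?_⟩
  · apply IsCoprime.pow
    rw [← sub_neg_eq_add, ← C_neg]
    apply isCoprime_X_sub_C_of_isUnit_sub
    rw [isUnit_iff_ne_zero, sub_neg_eq_add, ← two_mul]
    simpa using hre
  · simp only [pow_comp, sub_comp, X_comp, C_comp]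
    ring
  · have hc : z ^ 2 = ((z.re ^ 2 : ℝ) : ℂ) := by
      apply Complex.ext
      · simp [pow_two, hz]
      · simp [pow_two, hz]
    have hT := h.aeval_sq
    rw [sqPoly_eq_of_real hc, ← aeval_sq_eq] at hT
    rw [← hT]
    congr 1
    simp only [pow_comp, sub_comp, X_comp, C_comp, C_pow]
    ring

theorem encard_of_finrank_two_of_im_eq_zero (h : S.IsSimpleBlock z) (h2 : finrank ℝ V = 2)
    (hz : z.im = 0) : S.nullLagrangians.encard = 2 := by
  have := h.nontrivial
  obtain ⟨hcop, hpq, hzero⟩ := h.real_factorization hz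
  obtain ⟨hA, hB⟩ := S.ker_aeval_mem_nullLagrangians hcop hpq hzero
  rw [Set.encard_eq_two]
  refine ⟨_, _, S.ker_aeval_ne hcop hpq hzero, Set.Subset.antisymm (fun W hW => ?_) ?_⟩
  · rcases S.eq_or_eq_or_finrank_pos hcop hpq hzero hW with hWA | hWB | ⟨h₁, h₂, h₃⟩
    · exact Or.inl hWA
    · exact Or.inr hWB
    · omega
  · rintro W (rfl | rfl)
    · exact hA
    · exact hB

/-- Besides the two generalized eigenspaces there is the sum `ker (L² - c)` of the two eigenlines.
Any other invariant Lagrangian meets each generalized eigenspace in an invariant line, hence an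
eigenline, so it is this sum. -/
theorem encard_of_finrank_four_of_im_eq_zero (h : S.IsSimpleBlock z) (h4 : finrank ℝ V = 4)
    (hz : z.im = 0) : S.nullLagrangians.encard = 3 := by
  have := h.nontrivial
  obtain ⟨c, hc⟩ := exists_sq_eq_ofReal (Or.inr hz)
  have hE := h.ker_sq_sub_mem_nullLagrangians h4 hc
  obtain ⟨hcop, hpq, hzero⟩ := h.real_factorization hz
  obtain ⟨hA, hB⟩ := S.ker_aeval_mem_nullLagrangians hcop hpq hzero
  have hdis := disjoint_ker_aeval_of_isCoprime S.vectorField hcop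
  have hAB := S.ker_aeval_ne hcop hpq hzero
  have hinvA : ∀ x, x ∈ LinearMap.ker (aeval S.vectorField ((X - C z.re : ℝ[X]) ^ 2)) → _ :=
    fun x => S.vectorField_mem_ker_aeval ((X - C z.re) ^ 2) (x := x)
  have hinvB : ∀ x, x ∈ LinearMap.ker (aeval S.vectorField ((X + C z.re : ℝ[X]) ^ 2)) → _ :=
    fun x => S.vectorField_mem_ker_aeval ((X + C z.re) ^ 2) (x := x)
  have hzre : z = (z.re : ℂ) := Complex.ext (by simp) (by simp [hz])
  have hrec : z.re ^ 2 = c := by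
    rw [hzre] at hc
    exact_mod_cast hc
  have hmemE : ∀ (a : ℝ) x, a ^ 2 = c → S.vectorField x = a • x →
      x ∈ LinearMap.ker (aeval (S.vectorField ^ 2) (X - C c)) := by
    intro a x ha hx
    rw [LinearMap.mem_ker]
    simp [pow_two, hx, smul_smul, ← ha]
  have hmem : z ∈ S.eigenvalues := h.eigenvalues_eq ▸ mem_quadruplet_self z
  -- An eigenvector for `-z.re` lies in `ker (L² - c)` and in the opposite generalized eigenspace,
  -- which is disjoint from this one.
  have hEA : LinearMap.ker (aeval S.vectorField ((X - C z.re : ℝ[X]) ^ 2)) ≠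
      LinearMap.ker (aeval (S.vectorField ^ 2) (X - C c)) := by
    intro hEq
    obtain ⟨x, hx0, hx⟩ := S.exists_real_eigenvector (a := -z.re) (by
      rw [Complex.ofReal_neg, ← hzre]
      exact S.neg_mem_eigenvalues hmem)
    refine hx0 (Submodule.disjoint_def.1 hdis x ?_ ?_)
    · rw [hEq]
      exact hmemE (-z.re) x (by rw [neg_sq, hrec]) hx
    · rw [LinearMap.mem_ker]
      simp [pow_two, hx]
  have hEB : LinearMap.ker (aeval S.vectorField ((X + C z.re : ℝ[X]) ^ 2)) ≠
      LinearMap.ker (aeval (S.vectorField ^ 2) (X - C c)) := by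
    intro hEq
    obtain ⟨x, hx0, hx⟩ := S.exists_real_eigenvector (a := z.re) (by rw [← hzre]; exact hmem)
    refine hx0 (Submodule.disjoint_def.1 hdis x ?_ ?_)
    · rw [LinearMap.mem_ker]
      simp [pow_two, hx]
    · rw [hEq]
      exact hmemE z.re x hrec hx
  rw [Set.encard_eq_three]
  refine ⟨_, _, _, hAB, hEA, hEB, Set.Subset.antisymm (fun W hW => ?_) ?_⟩
  · rcases S.eq_or_eq_or_finrank_pos hcop hpq hzero hW with hWA | hWB | ⟨h₁, h₂, h₃⟩
    · exact Or.inl hWA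
    · exact Or.inr (Or.inl hWB)
    · right; right
      have hW' := (S.mem_nullLagrangians_iff).1 hW
      have hWd := (S.isLagrangian_iff.1 hW'.1).2
      have hEd := (S.isLagrangian_iff.1 ((S.mem_nullLagrangians_iff).1 hE).1).2
      have key : ∀ U : Submodule ℝ V, finrank ℝ U = 1 → (∀ x ∈ U, S.vectorField x ∈ U) →
          U ≤ LinearMap.ker (aeval (S.vectorField ^ 2) (X - C c)) := by
        intro U hU hUinv x hx
        obtain ⟨a, ha, hae⟩ := S.exists_eigenvector_of_finrank_eq_one hU hUinv
        refine hmemE a x ?_ (ha x hx)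
        rw [h.eigenvalues_eq, ← aeval_sqPoly_eq_zero_iff, sqPoly_eq_of_real hc] at hae
        simp only [map_sub, aeval_X, aeval_C, Complex.coe_algebraMap, sub_eq_zero] at hae
        exact_mod_cast hae
      refine Submodule.eq_of_le_of_finrank_eq ?_ (by omega)
      rw [S.eq_sup_of_invariant hcop hzero hW'.2]
      refine sup_le (key _ (by omega) fun x hx => ⟨hW'.2 x hx.1, hinvA x hx.2⟩)
        (key _ (by omega) fun x hx => ⟨hW'.2 x hx.1, hinvB x hx.2⟩)
  · rintro W (rfl | rfl | rfl)
    · exact hA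
    · exact hB
    · exact hE

theorem encard_nullLagrangians (h : S.IsSimpleBlock z) :
    S.nullLagrangians.encard = factor (finrank ℝ V) z := by
  rcases h.finrank_eq with h2 | h4
  · rcases h.of_finrank_two h2 with hz | hz
    · rw [h.encard_of_finrank_two_of_re_eq_zero h2 hz]
      simp [factor, h2, hz]
    · have hre : z.re ≠ 0 := fun hr => h.im_ne_zero_of_re_eq_zero hr hz
      rw [h.encard_of_finrank_two_of_im_eq_zero h2 hz]
      simp [factor, h2, hz, hre]
  · by_cases hre : z.re = 0
    · rw [h.encard_of_finrank_four_of_re_eq_zero h4 hre]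
      simp [factor, h4, hre]
    · by_cases hz : z.im = 0
      · rw [h.encard_of_finrank_four_of_im_eq_zero h4 hz]
        simp [factor, h4, hz, hre]
      · rw [h.encard_of_generic hre hz]
        simp [factor, h4, hz, hre]

end IsSimpleBlock

end LinearHamiltonianSystem

end

theorem mainTheorem4 {V : Type*} [AddCommGroup V] [Module ℝ V] [FiniteDimensional ℝ V]
    (S : LinearHamiltonianSystem V)
    (hsig : S.signature = 0)
    (hcodim : S.codimension ≤ 1) :
    (∃ r : ℕ, Nonempty (S.Splitting r)) ∧
    ∀ (r : ℕ) (D : S.Splitting r),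
      (∀ j : Fin r,
        (Module.finrank ℝ (D.comp j) = 2 ∨ Module.finrank ℝ (D.comp j) = 4) ∧
        D.eigenvalue j ≠ 0 ∧
        (Module.finrank ℝ (D.comp j) = 2 →
          (D.eigenvalue j).re = 0 ∨ (D.eigenvalue j).im = 0) ∧
        (Module.finrank ℝ (D.comp j) = 4 →
          (D.eigenvalue j).re = 0 ∨ (D.eigenvalue j).im = 0 →
          (D.subsystem j).algMultiplicity (D.eigenvalue j) = 2 ∧
          (D.subsystem j).geomMultiplicity (D.eigenvalue j) = 1)) ∧
      {W : Submodule ℝ V | S.IsLagrangian W ∧ (W : Set V) ⊆ S.nullCone}.encard =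
        ((∏ j : Fin r, D.δ j : ℕ) : ℕ∞) := by
  refine ⟨S.exists_splitting, fun r D => ⟨fun j => ?_, ?_⟩⟩
  · have h := D.isSimpleBlock hsig hcodim j
    exact ⟨h.finrank_eq, h.ne_zero, h.of_finrank_two, fun h4 hz =>
      ⟨h.algMultiplicity_eq h4 hz, h.geomMultiplicity_eq⟩⟩
  · exact D.encard_nullLagrangians fun j => (D.isSimpleBlock hsig hcodim j).encard_nullLagrangians
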